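/- Let $S\subset\mathbb P^3_{\mathbb R}$ be the real quadric surface $w^2=x^2+y^2+z^2$, whose real locus $S(\mathbb R)$ is the two-dimensional sphere, and let $\pi\colon S\dashrightarrow\mathbb P^1$ be the projection $(w:x:y:z)\mapsto(w:z)$. Let $\mathrm{Bir}(S)$ be the group of birational maps $S\dashrightarrow S$ defined over $\mathbb R$. Let $\mathrm{Bir}(S/\pi)=\{g\in\mathrm{Bir}(S)\mid \pi g=\pi\}$, and let $\mathrm{Aut}(S(\mathbb R)/\pi)$ be the subgroup of those $g\in\mathrm{Bir}(S/\pi)$ such that $g$ and $g^{-1}$ are defined at every real point of $S$. **Theorem.** Let $g,g'\in\mathrm{Aut}(S(\mathbb R)/\pi)$ be elements of order $2$. Then $g$ and $g'$ are conjugate in $\mathrm{Bir}(S/\pi)$ if and only if they are conjugate in $\mathrm{Aut}(S(\mathbb R)/\pi)$. -/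

import Mathlib

namespace RealSphere

open MvPolynomial

noncomputable section

/-- The ring `ℝ[w, x, y, z]`, with `w = X 0`, `x = X 1`, `y = X 2`, `z = X 3`. -/
abbrev Poly : Type := MvPolynomial (Fin 4) ℝ

/-- The quadratic form `w² - x² - y² - z²`, an equation of the sphere `S` in `ℙ³` over `ℝ`. -/
def quadric : Poly := X 0 ^ 2 - X 1 ^ 2 - X 2 ^ 2 - X 3 ^ 2

/-- The homogeneous ideal of the surface `S ⊂ ℙ³`. -/
def idealS : Ideal Poly := Ideal.span {quadric}

/-- The substitution `p ↦ p(F₀, F₁, F₂, F₃)`. -/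
abbrev subst (F : Fin 4 → Poly) : Poly →ₐ[ℝ] Poly := aeval F

theorem subst_subst (F G : Fin 4 → Poly) (p : Poly) :
    subst G (subst F p) = subst (fun i => subst G (F i)) p := by
  have h : (subst G).comp (subst F) = subst (fun i => subst G (F i)) := by
    apply MvPolynomial.algHom_ext
    intro i
    simp
  exact DFunLike.congr_fun h p

/-! The ideal of `S` is prime. -/

/-- A linear change of variables which turns `w² - x²` into a product. -/
def changeVar : Poly ≃ₐ[ℝ] Poly :=
  AlgEquiv.ofAlgHom
    (aeval ![C 2⁻¹ * (X 0 + X 1), C 2⁻¹ * (X 0 - X 1), X 2, X 3])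
    (aeval ![X 0 + X 1, X 0 - X 1, X 2, X 3])
    (by
      apply MvPolynomial.algHom_ext
      intro i
      have h : (C 2⁻¹ : Poly) + C 2⁻¹ = 1 := by
        rw [← C_add]; norm_num
      fin_cases i
      · simp; linear_combination (X 0) * h
      · simp; linear_combination (X 1) * h
      · simp
      · simp)
    (by
      apply MvPolynomial.algHom_ext
      intro i
      have h : (C 2⁻¹ : Poly) + C 2⁻¹ = 1 := by
        rw [← C_add]; norm_num
      fin_cases i
      · simp; linear_combination (X 0) * h
      · simp; linear_combination (X 1) * h
      · simp
      · simp)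

theorem irreducible_quadric : Irreducible quadric := by
  apply Irreducible.of_map (f := changeVar)
  have e : changeVar quadric = X 0 * X 1 + -(X 2 ^ 2 + X 3 ^ 2) := by
    have h : (C 2⁻¹ : Poly) + C 2⁻¹ = 1 := by
      rw [← C_add]; norm_num
    simp [changeVar, quadric]
    linear_combination (X 0 * X 1) * (C 2⁻¹ + C 2⁻¹ + 1) * h
  rw [e]
  have hX : Prime (X 0 : Poly) := X_prime
  apply irreducible_mul_X_add
  · exact X_ne_zero _
  · simp [vars_X]
  · intro hmem
    have h1 := vars_neg (X 2 ^ 2 + X 3 ^ 2 : Poly) ▸ hmem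
    have h2 := vars_add_subset _ _ h1
    rcases Finset.mem_union.1 h2 with h3 | h3 <;>
      · have h4 := vars_pow _ _ h3
        simp [vars_X] at h4
  · rw [hX.irreducible.isRelPrime_iff_not_dvd]
    rintro ⟨q, hq⟩
    have := congrArg (eval (![0, 0, 1, 0] : Fin 4 → ℝ)) hq
    simp at this

instance isPrime_idealS : idealS.IsPrime :=
  (Ideal.span_singleton_prime irreducible_quadric.ne_zero).2 irreducible_quadric.prime

theorem eval_eq_zero_of_mem {p : Poly} (hp : p ∈ idealS) {v : Fin 4 → ℝ}
    (hv : eval v quadric = 0) : eval v p = 0 := by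
  obtain ⟨q, rfl⟩ := Ideal.mem_span_singleton.1 hp
  simp [hv]

theorem X_notMem_idealS (i : Fin 4) : (X i : Poly) ∉ idealS := by
  intro h
  have h1 := eval_eq_zero_of_mem h (v := ![5, 3, 4, 0]) (by simp [quadric]; norm_num)
  have h2 := eval_eq_zero_of_mem h (v := ![1, 0, 0, 1]) (by simp [quadric])
  fin_cases i <;> simp at h1 h2

theorem subst_mem {F : Fin 4 → Poly} (hF : subst F quadric ∈ idealS) {p : Poly}
    (hp : p ∈ idealS) : subst F p ∈ idealS := by
  obtain ⟨q, rfl⟩ := Ideal.mem_span_singleton.1 hp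
  rw [map_mul]
  exact Ideal.mul_mem_right _ _ hF

/-- A homogeneous polynomial of degree `n` scales by `c ^ n`. -/
theorem subst_scale {p : Poly} {n : ℕ} (hp : p.IsHomogeneous n) (c : Poly) (H : Fin 4 → Poly) :
    subst (fun i => c * H i) p = c ^ n * subst H p := by
  simp only [subst, aeval_def, eval₂_eq', Finset.mul_sum]
  refine Finset.sum_congr rfl fun d hd => ?_
  have hd' : ∑ i, d i = n := by
    have := hp (mem_support_iff.1 hd)
    rw [← this, Finsupp.weight_apply, Finsupp.sum_fintype _ _ (by simp)]
    simp
  simp only [mul_pow, Finset.prod_mul_distrib, Finset.prod_pow_eq_pow_sum, hd']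
  ring

/-- Substitution respects congruence modulo the ideal of `S`. -/
theorem subst_congr {F G : Fin 4 → Poly} (h : ∀ i, F i - G i ∈ idealS) (p : Poly) :
    subst F p - subst G p ∈ idealS := by
  rw [← Ideal.Quotient.eq]
  have e : ∀ H : Fin 4 → Poly, Ideal.Quotient.mk idealS (subst H p) =
      aeval (fun i => Ideal.Quotient.mk idealS (H i)) p := fun H => by
    rw [subst, map_aeval, aeval_def]
    rfl
  rw [e, e]
  have : (fun i => Ideal.Quotient.mk idealS (F i)) = fun i => Ideal.Quotient.mk idealS (G i) :=
    funext fun i => Ideal.Quotient.eq.2 (h i)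
  rw [this]

/-- If `F` and `G` are proportional modulo the ideal of `S`, then so are the values at `F` and `G`
of a homogeneous polynomial. -/
theorem subst_proportional {F G : Fin 4 → Poly} (h : ∀ i j, F i * G j - F j * G i ∈ idealS)
    {p : Poly} {n : ℕ} (hp : p.IsHomogeneous n) (k : Fin 4) :
    G k ^ n * subst F p - F k ^ n * subst G p ∈ idealS := by
  rw [← subst_scale hp, ← subst_scale hp]
  refine subst_congr (fun i => ?_) p
  have := h i k
  convert this using 1
  ring

/-- Cancellation modulo the ideal of `S`. -/
theorem mem_of_mul_mem {c p : Poly} (hc : c ∉ idealS) (h : c * p ∈ idealS) : p ∈ idealS :=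
  (isPrime_idealS.mem_or_mem h).resolve_left hc

/-- Homogeneous coordinates of the real points of `S`. -/
def IsRealPoint (v : Fin 4 → ℝ) : Prop := v ≠ 0 ∧ eval v quadric = 0

/-! Dominant rational maps from `S` to itself. -/

/-- Homogeneous coordinates of a dominant rational map `S ⇢ S` defined over `ℝ`: a quadruple of
homogeneous polynomials of the same degree, which satisfies the equation of `S` on `S`, and such that
no proper closed subset of `S` contains the image. The last condition implies that no `F i` vanishes
identically on `S` (take `p = X i`). -/
structure Rep where
  deg : ℕ
  F : Fin 4 → Poly
  homogeneous : ∀ i, (F i).IsHomogeneous deg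
  mapsTo : subst F quadric ∈ idealS
  dominant : ∀ (p : Poly) (n : ℕ), p.IsHomogeneous n → subst F p ∈ idealS → p ∈ idealS

namespace Rep

theorem F_notMem (f : Rep) (i : Fin 4) : f.F i ∉ idealS := fun h =>
  X_notMem_idealS i (f.dominant (X i) 1 (isHomogeneous_X ℝ i) (by simpa using h))

/-- Two quadruples define the same rational map if they are proportional on `S`. -/
instance setoid : Setoid Rep where
  r f g := ∀ i j, f.F i * g.F j - f.F j * g.F i ∈ idealS
  iseqv := by
    refine ⟨fun f i j => ?_, fun {f g} h i j => ?_, fun {f g k} h h' i j => ?_⟩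
    · rw [mul_comm, sub_self]
      exact idealS.zero_mem
    · have := idealS.neg_mem (h i j)
      convert this using 1
      ring
    · refine mem_of_mul_mem (g.F_notMem 0) ?_
      have h1 := idealS.mul_mem_left (k.F j) (h i 0)
      have h2 := idealS.mul_mem_left (k.F i) (h j 0)
      have h3 := idealS.mul_mem_left (f.F 0) (h' i j)
      have := idealS.add_mem (idealS.sub_mem h1 h2) h3
      convert this using 1
      ring

theorem equiv_def {f g : Rep} :
    f ≈ g ↔ ∀ i j, f.F i * g.F j - f.F j * g.F i ∈ idealS := Iff.rfl

/-- The identity `(w : x : y : z)`. -/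
def id : Rep where
  deg := 1
  F := X
  homogeneous := fun i => isHomogeneous_X ℝ i
  mapsTo := by
    rw [subst, aeval_X_left_apply]
    exact Ideal.subset_span (Set.mem_singleton quadric)
  dominant := fun p n _ h => by simpa [subst] using h

/-- The composition `f ∘ g`. -/
def comp (f g : Rep) : Rep where
  deg := g.deg * f.deg
  F := fun i => subst g.F (f.F i)
  homogeneous := fun i => by
    have := (f.homogeneous i).aeval g.F g.homogeneous
    exact this
  mapsTo := by
    rw [← subst_subst]
    exact subst_mem g.mapsTo f.mapsTo
  dominant := fun p n hp h => by
    rw [← subst_subst] at h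
    exact f.dominant p n hp
      (g.dominant _ (f.deg * n) (hp.aeval f.F f.homogeneous) h)

theorem comp_congr {f f' g g' : Rep} (hf : f ≈ f') (hg : g ≈ g') : f.comp g ≈ f'.comp g' := by
  have h1 : f.comp g ≈ f'.comp g := fun i j => by
    have := subst_mem g.mapsTo (hf i j)
    simpa [comp] using this
  have h2 : f'.comp g ≈ f'.comp g' := fun i j => by
    have hi := subst_proportional hg (f'.homogeneous i) 0
    have hj := subst_proportional hg (f'.homogeneous j) 0
    refine mem_of_mul_mem (c := g'.F 0 ^ f'.deg) (fun hm =>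
      g'.F_notMem 0 (isPrime_idealS.mem_of_pow_mem _ hm)) ?_
    have h1 := idealS.mul_mem_left (subst g'.F (f'.F j)) hi
    have h2 := idealS.mul_mem_left (subst g'.F (f'.F i)) hj
    have := idealS.sub_mem h1 h2
    convert this using 1
    simp only [comp]
    ring
  exact Setoid.trans h1 h2

end Rep

/-- Dominant rational maps `S ⇢ S` defined over `ℝ`. -/
def DomRat : Type := Quotient Rep.setoid

namespace DomRat

/-- The rational map with the given homogeneous coordinates. -/
def mk (f : Rep) : DomRat := Quotient.mk _ f

theorem mk_eq_mk {f g : Rep} :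
    mk f = mk g ↔ ∀ i j, f.F i * g.F j - f.F j * g.F i ∈ idealS :=
  Quotient.eq (r := Rep.setoid)

/-- Dominant rational maps `S ⇢ S` form a monoid under composition: `f * g` is `f ∘ g`. -/
instance : Monoid DomRat where
  mul := Quotient.map₂ Rep.comp fun _ _ hf _ _ hg => Rep.comp_congr hf hg
  one := mk Rep.id
  mul_assoc := by
    rintro ⟨f⟩ ⟨g⟩ ⟨h⟩
    refine congrArg mk ?_
    simp only [Rep.comp, Rep.mk.injEq]
    refine ⟨by ring, ?_⟩
    funext i
    exact (subst_subst _ _ _)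
  one_mul := by
    rintro ⟨f⟩
    refine congrArg mk ?_
    cases f
    simp [Rep.comp, Rep.id]
  mul_one := by
    rintro ⟨f⟩
    refine congrArg mk ?_
    cases f
    simp [Rep.comp, Rep.id]

theorem mk_mul_mk (f g : Rep) : mk f * mk g = mk (f.comp g) := rfl

theorem one_def : (1 : DomRat) = mk Rep.id := rfl

/-- The rational map `f` is defined at the point of `S` with homogeneous coordinates `v`: it has
homogeneous coordinates which do not all vanish at `v`. -/
def DefinedAt (f : DomRat) (v : Fin 4 → ℝ) : Prop :=
  ∃ F : Rep, mk F = f ∧ ∃ i, eval v (F.F i) ≠ 0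

/-- The rational map `f` satisfies `π ∘ f = π`, where `π : S ⇢ ℙ¹`, `(w : x : y : z) ↦ (w : z)`.
For homogeneous coordinates `F` of `f`, the map `π ∘ f` is `(F 0 : F 3)`, and neither `F 0`
nor `F 3` vanishes identically on `S`. -/
def OverBase (f : DomRat) : Prop :=
  ∃ F : Rep, mk F = f ∧ F.F 0 * X 3 - F.F 3 * X 0 ∈ idealS

theorem definedAt_one {v : Fin 4 → ℝ} (hv : IsRealPoint v) : (1 : DomRat).DefinedAt v := by
  refine ⟨Rep.id, rfl, ?_⟩
  obtain ⟨i, hi⟩ := Function.ne_iff.1 hv.1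
  exact ⟨i, by simpa [Rep.id] using hi⟩

theorem definedAt_mul {f g : DomRat} (hf : ∀ u, IsRealPoint u → f.DefinedAt u) {v : Fin 4 → ℝ}
    (hg : g.DefinedAt v) (hv : IsRealPoint v) : (f * g).DefinedAt v := by
  obtain ⟨G, rfl, i, hi⟩ := hg
  have key : ∀ p : Poly, eval (fun i => eval v (G.F i)) p = eval v (subst G.F p) := fun p => by
    rw [subst, map_aeval]
    have : (eval v).comp (algebraMap ℝ Poly) = RingHom.id ℝ := by
      ext r
      simp
    rw [this]
    rfl
  have hu : IsRealPoint (fun i => eval v (G.F i)) :=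
    ⟨fun h => hi (congrFun h i), by rw [key]; exact eval_eq_zero_of_mem G.mapsTo hv.2⟩
  obtain ⟨F, rfl, j, hj⟩ := hf _ hu
  exact ⟨F.comp G, rfl, j, by rw [key] at hj; exact hj⟩

end DomRat

/-- `Bir(S)`: the invertible dominant rational maps `S ⇢ S` over `ℝ`, under composition. -/
abbrev Bir : Type := DomRatˣ

/-- `Bir(S/π)`: the elements `f` of `Bir(S)` with `π ∘ f = π`. -/
def BirOver : Subgroup Bir where
  carrier := {f | (f : DomRat).OverBase}
  one_mem' := ⟨Rep.id, rfl, by simp [Rep.id, mul_comm]⟩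
  mul_mem' := by
    rintro f g ⟨F, hF, hF'⟩ ⟨G, hG, hG'⟩
    refine ⟨F.comp G, by rw [← DomRat.mk_mul_mk, hF, hG]; rfl, ?_⟩
    have h1 := subst_mem G.mapsTo hF'
    simp only [map_sub, map_mul, aeval_X] at h1
    refine mem_of_mul_mem (G.F_notMem 0) ?_
    have h2 := idealS.mul_mem_left (X 0) h1
    have h3 := idealS.mul_mem_left (subst G.F (F.F 0)) hG'
    have := idealS.add_mem h2 h3
    convert this using 1
    simp only [Rep.comp]
    ring
  inv_mem' := by
    rintro f ⟨F, hF, hF'⟩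
    obtain ⟨G, hG⟩ := Quotient.exists_rep ((f⁻¹ : Bir) : DomRat)
    refine ⟨G, hG, ?_⟩
    have hFG : DomRat.mk (F.comp G) = DomRat.mk Rep.id := by
      rw [← DomRat.mk_mul_mk, hF, ← DomRat.one_def]
      rw [show DomRat.mk G = ((f⁻¹ : Bir) : DomRat) from hG]
      exact f.mul_inv
    have h0 := DomRat.mk_eq_mk.1 hFG 0 3
    simp only [Rep.comp, Rep.id] at h0
    have h1 := subst_mem G.mapsTo hF'
    simp only [map_sub, map_mul, aeval_X] at h1
    refine mem_of_mul_mem ((F.comp G).F_notMem 0) ?_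
    have := idealS.sub_mem (idealS.mul_mem_left (G.F 0) h0) (idealS.mul_mem_left (X 0) h1)
    convert this using 1
    simp only [Rep.comp]
    ring

/-- `Aut(S(ℝ))`: the elements `f` of `Bir(S)` such that `f` and `f⁻¹` are defined at every real point
of `S` (the birational diffeomorphisms of `S`). -/
def AutReal : Subgroup Bir where
  carrier := {f | ∀ v, IsRealPoint v →
    (f : DomRat).DefinedAt v ∧ ((f⁻¹ : Bir) : DomRat).DefinedAt v}
  one_mem' := fun v hv => by
    rw [inv_one]
    exact ⟨DomRat.definedAt_one hv, DomRat.definedAt_one hv⟩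
  mul_mem' := by
    intro f g hf hg v hv
    rw [mul_inv_rev]
    exact ⟨DomRat.definedAt_mul (fun u hu => (hf u hu).1) (hg v hv).1 hv,
      DomRat.definedAt_mul (fun u hu => (hg u hu).2) (hf v hv).2 hv⟩
  inv_mem' := by
    intro f hf v hv
    rw [inv_inv]
    exact (hf v hv).symm

/-- `Aut(S(ℝ)/π)`: the elements `f` of `Aut(S(ℝ))` with `π ∘ f = π`. -/
def AutRealOver : Subgroup Bir := AutReal ⊓ BirOver

theorem AutRealOver_le_BirOver : AutRealOver ≤ BirOver := inf_le_right

end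

end RealSphere

/-!
Projection to `(w : z)` makes `S` a conic bundle over the line with coordinate `t = z / w`: the
generic fibre is the conic `x² + y² = (1 - t²) w²` over `ℝ(t)`, and the real points of `S` form
circles over `-1 < t < 1` together with the two poles over `t = ±1`. In outline, the elements of
order two in `Bir(S/π)` are the orthogonal reflections of the quadratic form
`q = x² + y² - (1 - t²) w²`, and the theorem becomes a statement about vectors for `q`.

*Birational maps over the base.* Over `ℂ(t)` the coordinate `ζ = x + i y`, with
`x - i y = (1 - t²) / ζ`, parametrizes the conic, so a birational map over the base induces an
automorphism of `ℂ(t)(ζ)`. The image of `ζ` generates this field, and Lüroth's degree formula shows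
that it is a Möbius transformation of `ζ` with coefficients in `ℂ[t]` (`exists_mob`). As the real
points are Zariski dense, its matrix determines the map, and is determined by it up to scalar
(`Mob.ext`, `Mob.unique`).

*Involutions.* The matrix of an involution has trace zero, and since the map is real, the matrix is
up to scalar that of the reflection in a vector `v` with polynomial entries
(`exists_refl_of_involution`). Here `v` may be taken without common zeros. Where `q(v)` vanishes for
some `t ∈ (-1, 1)`, the reflection contracts the circle to a point; hence `q(v)` has constant sign
on `(-1, 1)` if the reflection and its inverse are defined at the real points (`Q_eval_ne_zero`).
Behaviour at the poles leaves two types (`exists_refl_of_mem_autRealOver`): either `q(v) > 0` on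
`[-1, 1]`, or `q(v) = (1 - t²) Q` with `Q < 0` on `[-1, 1]`. Conversely, vectors of these two types
give reflections in `Aut(S(ℝ)/π)` (`ReflData.unit_mem_autRealOver`).

*The invariant.* The determinants of the matrices of conjugate reflections agree up to sign and
squares (`exists_det_mul_det_eq`). The parity of the order of vanishing at `t = 1` therefore
separates the two types, and for two conjugate reflections of the same type the product
`q(v) q(v')` is a square; so `q(v) = q(v')` after rescaling both vectors.

*Conjugation.* If `q(v) = q(v')`, the reflection in `v + v'` conjugates one reflection into the
other (`ReflData.unit_add_mul`), and it lies in `Aut(S(ℝ)/π)` as soon as `v + v'` is of the same type as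
`v` and `v'`. For timelike vectors, `q < 0`, this holds after a change of sign of `v'`, by the
reversed Cauchy–Schwarz inequality. For spacelike vectors, the set of vectors `q > 0` is connected
but not convex; `v` is first moved towards `v'` by a reflection in a horizontal vector
`(y₁, y₂, 0)`, where `y₁ + i y₂` approximates a continuous square root of `m m'`, with `m` and `m'`
the horizontal parts of `v` and `v'` as complex functions of `t`. Such a square root exists since
`m` and `m'` have no zeros on `[-1, 1]`, and polynomial approximations exist by the Weierstrass
theorem (`exists_polynomial_spacelike`).
-/

namespace RealSphere

noncomputable section

open Polynomial

/-! ### Real points of the sphere -/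

/-- Substituting multiples `c * H i` into a homogeneous polynomial of degree `n` gives a factor
`c ^ n`. -/
theorem eval₂_mul_of_isHomogeneous {R S σ : Type*} [CommSemiring R] [CommSemiring S] [Fintype σ]
    (φ : R →+* S) {p : MvPolynomial σ R} {n : ℕ} (hp : p.IsHomogeneous n) (c : S) (H : σ → S) :
    MvPolynomial.eval₂ φ (fun i => c * H i) p = c ^ n * MvPolynomial.eval₂ φ H p := by
  simp only [MvPolynomial.eval₂_eq', Finset.mul_sum]
  refine Finset.sum_congr rfl fun d hd => ?_
  have hd' : ∑ i, d i = n := by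
    have := hp (MvPolynomial.mem_support_iff.1 hd)
    rw [← this, Finsupp.weight_apply, Finsupp.sum_fintype _ _ (by simp)]
    simp
  simp only [mul_pow, Finset.prod_mul_distrib, Finset.prod_pow_eq_pow_sum, hd']
  ring

theorem eval_mul_of_isHomogeneous {p : Poly} {n : ℕ} (hp : p.IsHomogeneous n) (c : ℝ)
    (v : Fin 4 → ℝ) :
    MvPolynomial.eval (fun i => c * v i) p = c ^ n * MvPolynomial.eval v p :=
  eval₂_mul_of_isHomogeneous (RingHom.id ℝ) hp c v

/-- Evaluation of a substitution. -/
theorem eval_subst (F : Fin 4 → Poly) (v : Fin 4 → ℝ) (p : Poly) :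
    MvPolynomial.eval v (subst F p) =
      MvPolynomial.eval (fun i => MvPolynomial.eval v (F i)) p := by
  rw [subst, MvPolynomial.map_aeval]
  have : (MvPolynomial.eval v).comp (algebraMap ℝ Poly) = RingHom.id ℝ := by
    ext r
    simp
  rw [this]
  rfl

/-- The point of `ℝ⁴` over the affine point `(x, y, t)` of the chart `w = 1`. -/
def pt (x y t : ℝ) : Fin 4 → ℝ := ![1, x, y, t]

@[simp] theorem pt_zero (x y t : ℝ) : pt x y t 0 = 1 := rfl

@[simp] theorem pt_one (x y t : ℝ) : pt x y t 1 = x := rfl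

@[simp] theorem pt_two (x y t : ℝ) : pt x y t 2 = y := rfl

@[simp] theorem pt_three (x y t : ℝ) : pt x y t 3 = t := rfl

/-- The affine point `(x, y, t)` lies on the sphere and differs from the poles `(0, 0, ±1)`. -/
def OnSphere (x y t : ℝ) : Prop := x ^ 2 + y ^ 2 = 1 - t ^ 2 ∧ -1 < t ∧ t < 1

theorem eval_quadric (v : Fin 4 → ℝ) :
    MvPolynomial.eval v quadric = v 0 ^ 2 - v 1 ^ 2 - v 2 ^ 2 - v 3 ^ 2 := by
  simp [quadric]

theorem OnSphere.eval_quadric {x y t : ℝ} (h : OnSphere x y t) :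
    MvPolynomial.eval (pt x y t) quadric = 0 := by
  rw [RealSphere.eval_quadric]
  simp only [pt_zero, pt_one, pt_two, pt_three]
  linarith [h.1]

theorem OnSphere.isRealPoint {x y t : ℝ} (h : OnSphere x y t) : IsRealPoint (pt x y t) :=
  ⟨fun h0 => by simpa using congrFun h0 0, h.eval_quadric⟩

theorem OnSphere.eval_eq_zero {x y t : ℝ} (h : OnSphere x y t) {p : Poly} (hp : p ∈ idealS) :
    MvPolynomial.eval (pt x y t) p = 0 :=
  eval_eq_zero_of_mem hp h.eval_quadric

/-- Modulo the equation of `S`, every polynomial is of degree at most `1` in `y`. -/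
theorem exists_sub_mem_idealS (p : Poly) : ∃ a b : MvPolynomial (Fin 3) ℝ,
    p - (MvPolynomial.rename ![0, 1, 3] a +
      MvPolynomial.rename ![0, 1, 3] b * MvPolynomial.X 2) ∈ idealS := by
  induction p using MvPolynomial.induction_on with
  | C r => exact ⟨MvPolynomial.C r, 0, by simp⟩
  | add p q hp hq =>
    obtain ⟨a, b, h⟩ := hp
    obtain ⟨a', b', h'⟩ := hq
    refine ⟨a + a', b + b', ?_⟩
    convert idealS.add_mem h h' using 1
    simp only [map_add]
    ring
  | mul_X p i hp =>
    obtain ⟨a, b, h⟩ := hp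
    have h1 := idealS.mul_mem_right (MvPolynomial.X i) h
    by_cases hi : i = 2
    · subst hi
      refine ⟨b * (MvPolynomial.X 0 ^ 2 - MvPolynomial.X 1 ^ 2 - MvPolynomial.X 2 ^ 2), a, ?_⟩
      have h2 : quadric ∈ idealS := Ideal.subset_span rfl
      convert idealS.sub_mem h1 (idealS.mul_mem_left (MvPolynomial.rename ![0, 1, 3] b) h2) using 1
      simp only [map_mul, map_sub, map_pow, MvPolynomial.rename_X, quadric, Matrix.cons_val]
      ring
    · obtain ⟨j, hj⟩ : ∃ j : Fin 3, (![0, 1, 3] : Fin 3 → Fin 4) j = i := by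
        fin_cases i
        · exact ⟨0, rfl⟩
        · exact ⟨1, rfl⟩
        · exact absurd rfl hi
        · exact ⟨2, rfl⟩
      refine ⟨a * MvPolynomial.X j, b * MvPolynomial.X j, ?_⟩
      convert h1 using 1
      simp only [map_mul, MvPolynomial.rename_X, hj]
      ring

/-- A homogeneous polynomial which vanishes at the real points of `S` outside the poles vanishes
on `S`. -/
theorem mem_idealS_of_eval {p : Poly} {n : ℕ} (hp : p.IsHomogeneous n)
    (h : ∀ x y t, OnSphere x y t → MvPolynomial.eval (pt x y t) p = 0) : p ∈ idealS := by
  obtain ⟨a, b, hab⟩ := exists_sub_mem_idealS p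
  have key : ∀ v : Fin 3 → ℝ, v 1 ^ 2 + v 2 ^ 2 < v 0 ^ 2 → v 0 ≠ 0 →
      MvPolynomial.eval v a = 0 ∧ MvPolynomial.eval v b = 0 := by
    intro v hv hv0
    have hr : 0 < v 0 ^ 2 - v 1 ^ 2 - v 2 ^ 2 := by linarith
    obtain ⟨r, hr0, hr⟩ : ∃ r : ℝ, r ≠ 0 ∧ r ^ 2 = v 0 ^ 2 - v 1 ^ 2 - v 2 ^ 2 :=
      ⟨_, (Real.sqrt_pos.2 hr).ne', Real.sq_sqrt hr.le⟩
    have main : ∀ r : ℝ, r ≠ 0 → r ^ 2 = v 0 ^ 2 - v 1 ^ 2 - v 2 ^ 2 →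
        MvPolynomial.eval v a + MvPolynomial.eval v b * r = 0 := by
      intro r hr0 hr
      have hon : OnSphere (v 1 / v 0) (r / v 0) (v 2 / v 0) := by
        have hlt : (v 2 / v 0) ^ 2 < 1 := by
          rw [div_pow, div_lt_one (by positivity)]
          nlinarith [sq_nonneg (v 1), sq_nonneg (v 2)]
        refine ⟨?_, abs_lt.1 (by simpa using hlt)⟩
        field_simp
        linarith
      have h0 : MvPolynomial.eval ![v 0, v 1, r, v 2] p = 0 := by
        have := eval_mul_of_isHomogeneous hp (v 0) (pt (v 1 / v 0) (r / v 0) (v 2 / v 0))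
        rw [h _ _ _ hon, mul_zero] at this
        rw [← this]
        congr 2
        funext i
        fin_cases i <;> simp [pt] <;> field_simp
      have h1 := eval_eq_zero_of_mem hab (v := ![v 0, v 1, r, v 2]) (by
        rw [eval_quadric]; simp; linarith)
      have hcomp : (![v 0, v 1, r, v 2] ∘ ![0, 1, 3] : Fin 3 → ℝ) = v := by
        funext i
        fin_cases i <;> rfl
      simp only [map_sub, map_add, map_mul, MvPolynomial.eval_rename, hcomp, h0,
        MvPolynomial.eval_X, Matrix.cons_val] at h1
      linarith
    have e1 := main r hr0 hr
    have e2 := main (-r) (neg_ne_zero.2 hr0) (by rw [neg_sq, hr])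
    refine ⟨by linarith, ?_⟩
    have : MvPolynomial.eval v b * r = 0 := by linarith
    exact (mul_eq_zero.1 this).resolve_right hr0
  have hbox : ∀ v ∈ Set.pi Set.univ
      (![Set.Icc 2 3, Set.Icc 0 1, Set.Icc 0 1] : Fin 3 → Set ℝ),
      v 1 ^ 2 + v 2 ^ 2 < v 0 ^ 2 ∧ v 0 ≠ 0 := by
    intro v hv
    have h0 : v 0 ∈ Set.Icc (2 : ℝ) 3 := hv 0 trivial
    have h1 : v 1 ∈ Set.Icc (0 : ℝ) 1 := hv 1 trivial
    have h2 : v 2 ∈ Set.Icc (0 : ℝ) 1 := hv 2 trivial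
    exact ⟨by nlinarith [h0.1, h1.1, h1.2, h2.1, h2.2], by linarith [h0.1]⟩
  have hinf : ∀ i, ((![Set.Icc 2 3, Set.Icc 0 1, Set.Icc 0 1] : Fin 3 → Set ℝ) i).Infinite := by
    intro i
    fin_cases i
    · exact Set.Icc_infinite (by norm_num)
    · exact Set.Icc_infinite (by norm_num)
    · exact Set.Icc_infinite (by norm_num)
  have ha : a = 0 := MvPolynomial.funext_set _ hinf fun v hv => by
    rw [(key v (hbox v hv).1 (hbox v hv).2).1, map_zero]
  have hb : b = 0 := MvPolynomial.funext_set _ hinf fun v hv => by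
    rw [(key v (hbox v hv).1 (hbox v hv).2).2, map_zero]
  simpa [ha, hb] using hab

theorem exists_eval_ne_zero {p : Poly} {n : ℕ} (hp : p.IsHomogeneous n) (h : p ∉ idealS) :
    ∃ x y t, OnSphere x y t ∧ MvPolynomial.eval (pt x y t) p ≠ 0 := by
  by_contra! hc
  exact h (mem_idealS_of_eval hp hc)

/-- If a polynomial in `ζ = x + i y` of degree at most `2`, whose coefficients are polynomials in
`t`, vanishes at the real points of a nonempty Zariski open subset of `S`, then its coefficients
are zero. -/
theorem coeff_eq_zero_of_generic {K : Poly} {n : ℕ} (hK : K.IsHomogeneous n) (hK' : K ∉ idealS)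
    {A₀ A₁ A₂ : ℂ[X]}
    (h : ∀ x y t, OnSphere x y t → MvPolynomial.eval (pt x y t) K ≠ 0 →
      A₂.eval (t : ℂ) * (x + y * Complex.I) ^ 2 + A₁.eval (t : ℂ) * (x + y * Complex.I) +
        A₀.eval (t : ℂ) = 0) :
    A₀ = 0 ∧ A₁ = 0 ∧ A₂ = 0 := by
  obtain ⟨x₀, y₀, t₀, hon, hne⟩ := exists_eval_ne_zero hK hK'
  -- The parametrization of the sphere by an angle and the height.
  let γ : ℝ × ℝ → Fin 4 → ℝ := fun q =>
    pt (√(1 - q.2 ^ 2) * Real.cos q.1) (√(1 - q.2 ^ 2) * Real.sin q.1) q.2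
  have hγ : Continuous γ := by
    refine continuous_pi fun i => ?_
    fin_cases i <;> simp [γ, pt] <;> fun_prop
  have hcont : Continuous fun q => MvPolynomial.eval (γ q) K :=
    (MvPolynomial.continuous_eval K).comp hγ
  obtain ⟨θ₀, hθ₀⟩ : ∃ θ, γ (θ, t₀) = pt x₀ y₀ t₀ := by
    refine ⟨(x₀ + y₀ * Complex.I : ℂ).arg, ?_⟩
    have hn : ‖(x₀ + y₀ * Complex.I : ℂ)‖ = √(1 - t₀ ^ 2) := by
      rw [Complex.norm_add_mul_I, hon.1]
    have h1 := Complex.norm_mul_cos_arg (x₀ + y₀ * Complex.I : ℂ)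
    have h2 := Complex.norm_mul_sin_arg (x₀ + y₀ * Complex.I : ℂ)
    rw [hn] at h1 h2
    simp only [γ, h1, h2]
    simp
  have hopen : IsOpen ({q : ℝ × ℝ | MvPolynomial.eval (γ q) K ≠ 0} ∩
      {q | -1 < q.2 ∧ q.2 < 1}) := by
    refine (isOpen_ne_fun hcont continuous_const).inter ?_
    exact (isOpen_lt continuous_const continuous_snd).inter
      (isOpen_lt continuous_snd continuous_const)
  have hmem : (θ₀, t₀) ∈ ({q : ℝ × ℝ | MvPolynomial.eval (γ q) K ≠ 0} ∩
      {q | -1 < q.2 ∧ q.2 < 1}) := ⟨by simpa [hθ₀] using hne, hon.2⟩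
  obtain ⟨U, V, hU, hV, hθU, htV, hUV⟩ := isOpen_prod_iff.1 hopen _ _ hmem
  have hvanish : ∀ t ∈ V, A₀.eval (t : ℂ) = 0 ∧ A₁.eval (t : ℂ) = 0 ∧ A₂.eval (t : ℂ) = 0 := by
    intro t ht
    have hst : 0 < 1 - t ^ 2 := by
      have := (hUV (Set.mk_mem_prod hθU ht)).2
      nlinarith [this.1, this.2]
    set p : ℂ[X] := C (A₂.eval (t : ℂ)) * X ^ 2 + C (A₁.eval (t : ℂ)) * X + C (A₀.eval (t : ℂ))
      with hp
    have hp0 : p = 0 := by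
      -- The circle at height `t` meets the open set in an arc, on which the angle is injective.
      obtain ⟨ε, hε, hball⟩ := Metric.isOpen_iff.1 hU θ₀ hθU
      have hinj : Set.InjOn (fun θ : ℝ => (√(1 - t ^ 2) : ℂ) * Complex.exp (θ * Complex.I))
          (Set.Ioo θ₀ (θ₀ + min ε 1)) := by
        intro θ hθ θ' hθ' hEq
        have hsq : (√(1 - t ^ 2) : ℂ) ≠ 0 := by
          exact_mod_cast (Real.sqrt_pos.2 hst).ne'
        have h1 := mul_left_cancel₀ hsq hEq
        obtain ⟨k, hk⟩ := Complex.exp_eq_exp_iff_exists_int.1 h1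
        have hk' : θ = θ' + k * (2 * Real.pi) := by
          have : (θ : ℂ) * Complex.I = ((θ' + k * (2 * Real.pi) : ℝ) : ℂ) * Complex.I := by
            rw [hk]; push_cast; ring
          exact_mod_cast mul_right_cancel₀ Complex.I_ne_zero this
        have hlt : |θ - θ'| < 1 := by
          have := min_le_right ε 1
          rw [abs_lt]
          constructor <;> linarith [hθ.1, hθ.2, hθ'.1, hθ'.2]
        have hk0 : k = 0 := by
          by_contra hk0
          have : (1 : ℝ) ≤ |(k : ℝ)| := by exact_mod_cast Int.one_le_abs hk0
          rw [hk', add_sub_cancel_left, abs_mul, abs_of_pos Real.two_pi_pos] at hlt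
          nlinarith [Real.pi_gt_three]
        simpa [hk0] using hk'
      refine Polynomial.eq_zero_of_infinite_isRoot p (Set.Infinite.mono ?_
        ((Set.Ioo_infinite (by simp [hε])).image hinj))
      rintro _ ⟨θ, hθ, rfl⟩
      have hθU : θ ∈ U := hball (by
        have := min_le_left ε 1
        rw [Metric.mem_ball, Real.dist_eq, abs_lt]
        constructor <;> linarith [hθ.1, hθ.2])
      have hm := hUV (Set.mk_mem_prod hθU ht)
      have := h _ _ t ⟨?_, hm.2⟩ hm.1
      · have hz : ((√(1 - t ^ 2) * Real.cos θ : ℝ) : ℂ) +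
            ((√(1 - t ^ 2) * Real.sin θ : ℝ) : ℂ) * Complex.I =
            (√(1 - t ^ 2) : ℂ) * Complex.exp (θ * Complex.I) := by
          rw [Complex.exp_mul_I]; push_cast; ring
        simp only [hz] at this
        simpa [hp, Polynomial.IsRoot] using this
      · have := Real.sq_sqrt hst.le
        linear_combination (Real.cos θ ^ 2 + Real.sin θ ^ 2) * this +
          (1 - t ^ 2) * Real.cos_sq_add_sin_sq θ
    have c0 := congrArg (fun q => q.coeff 0) hp0
    have c1 := congrArg (fun q => q.coeff 1) hp0
    have c2 := congrArg (fun q => q.coeff 2) hp0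
    simp [hp, Polynomial.coeff_X, Polynomial.coeff_C] at c0 c1 c2
    exact ⟨c0, c1, c2⟩
  obtain ⟨ε, hε, hball⟩ := Metric.isOpen_iff.1 hV t₀ htV
  have hVinf : (((↑) : ℝ → ℂ) '' V).Infinite := by
    refine Set.Infinite.image Complex.ofReal_injective.injOn ?_
    refine Set.Infinite.mono ?_ (Set.Ioo_infinite (show t₀ < t₀ + ε by linarith))
    intro t ht
    refine hball ?_
    rw [Metric.mem_ball, Real.dist_eq, abs_lt]
    constructor <;> linarith [ht.1, ht.2]
  refine ⟨?_, ?_, ?_⟩ <;> refine Polynomial.eq_zero_of_infinite_isRoot _ (hVinf.mono ?_) <;>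
    rintro _ ⟨t, ht, rfl⟩
  · exact (hvanish t ht).1
  · exact (hvanish t ht).2.1
  · exact (hvanish t ht).2.2

theorem mul_notMem_idealS {p q : Poly} (hp : p ∉ idealS) (hq : q ∉ idealS) : p * q ∉ idealS :=
  fun h => hq (mem_of_mul_mem hp h)

/-- A homogeneous polynomial which vanishes at the real points of a nonempty Zariski open subset of
`S` vanishes on `S`. -/
theorem mem_idealS_of_generic {p K : Poly} {m n : ℕ} (hp : p.IsHomogeneous m)
    (hK : K.IsHomogeneous n) (hK' : K ∉ idealS) {δ : ℂ[X]} (hδ : δ ≠ 0)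
    (h : ∀ x y t, OnSphere x y t → MvPolynomial.eval (pt x y t) K ≠ 0 → δ.eval (t : ℂ) ≠ 0 →
      MvPolynomial.eval (pt x y t) p = 0) : p ∈ idealS := by
  by_contra hp'
  refine hδ (coeff_eq_zero_of_generic (A₁ := 0) (A₂ := 0) (hK.mul hp)
    (mul_notMem_idealS hK' hp') fun x y t hon hne => ?_).1
  rw [map_mul] at hne
  simp only [eval_zero, zero_mul, zero_add]
  by_contra h0
  exact right_ne_zero_of_mul hne (h x y t hon (left_ne_zero_of_mul hne) h0)

/-! ### Möbius transformations in the complex coordinate -/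

/-- The rational map `f` preserves the circles `t = const` and acts on them, in the complex
coordinate `ζ = x + i y`, by the Möbius transformation with matrix `M` over `ℂ[t]`. The identity is
required at the real points of a nonempty Zariski open subset `K ≠ 0` of `S`. -/
structure Mob (f : DomRat) (M : Matrix (Fin 2) (Fin 2) ℂ[X]) : Prop where
  det_ne_zero : M.det ≠ 0
  exists_rep : ∃ (F : Rep) (K : Poly) (n : ℕ), DomRat.mk F = f ∧ K.IsHomogeneous n ∧ K ∉ idealS ∧
    ∀ x y t, OnSphere x y t → MvPolynomial.eval (pt x y t) K ≠ 0 →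
      MvPolynomial.eval (pt x y t) (F.F 0) ≠ 0 ∧
      MvPolynomial.eval (pt x y t) (F.F 3) = t * MvPolynomial.eval (pt x y t) (F.F 0) ∧
      ((MvPolynomial.eval (pt x y t) (F.F 1) : ℂ) +
        MvPolynomial.eval (pt x y t) (F.F 2) * Complex.I) *
          ((M 1 0).eval (t : ℂ) * (x + y * Complex.I) + (M 1 1).eval (t : ℂ)) =
      ((M 0 0).eval (t : ℂ) * (x + y * Complex.I) + (M 0 1).eval (t : ℂ)) *
        MvPolynomial.eval (pt x y t) (F.F 0)

theorem Mob.one : Mob 1 1 := by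
  refine ⟨by simp, Rep.id, 1, 0, rfl, MvPolynomial.isHomogeneous_one _ _, ?_, ?_⟩
  · exact (Ideal.ne_top_iff_one _).1 isPrime_idealS.ne_top
  · intro x y t _ _
    simp [Rep.id]

/-- At a point where its first coordinate does not vanish, the value of a map over the base lies on
the same circle. -/
theorem Rep.exists_pt (G : Rep) {x y t : ℝ} (hon : OnSphere x y t)
    (h0 : MvPolynomial.eval (pt x y t) (G.F 0) ≠ 0)
    (h3 : MvPolynomial.eval (pt x y t) (G.F 3) = t * MvPolynomial.eval (pt x y t) (G.F 0)) :
    ∃ x' y', OnSphere x' y' t ∧ ∀ i, MvPolynomial.eval (pt x y t) (G.F i) =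
      MvPolynomial.eval (pt x y t) (G.F 0) * pt x' y' t i := by
  have hq := hon.eval_eq_zero G.mapsTo
  rw [eval_subst, eval_quadric] at hq
  refine ⟨MvPolynomial.eval (pt x y t) (G.F 1) / MvPolynomial.eval (pt x y t) (G.F 0),
    MvPolynomial.eval (pt x y t) (G.F 2) / MvPolynomial.eval (pt x y t) (G.F 0),
    ⟨?_, hon.2⟩, fun i => ?_⟩
  · rw [h3] at hq
    field_simp
    linear_combination -hq
  · fin_cases i
    · simp
    · simp [mul_div_cancel₀ _ h0]
    · simp [mul_div_cancel₀ _ h0]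
    · simp [h3, mul_comm]

theorem Rep.eval_comp (F G : Rep) (v : Fin 4 → ℝ) (i : Fin 4) :
    MvPolynomial.eval v ((F.comp G).F i) =
      MvPolynomial.eval (fun j => MvPolynomial.eval v (G.F j)) (F.F i) :=
  eval_subst _ _ _

theorem Mob.mul {f g : DomRat} {M N : Matrix (Fin 2) (Fin 2) ℂ[X]} (hf : Mob f M)
    (hg : Mob g N) : Mob (f * g) (M * N) := by
  obtain ⟨hM, F, K, k, rfl, hK, hK', hF⟩ := hf
  obtain ⟨hN, G, L, l, rfl, hL, hL', hG⟩ := hg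
  refine ⟨by rw [Matrix.det_mul]; exact mul_ne_zero hM hN, F.comp G, L * subst G.F K,
    l + G.deg * k, rfl, hL.mul (hK.aeval G.F G.homogeneous),
    mul_notMem_idealS hL' fun h => hK' (G.dominant K k hK h), fun x y t hon hne => ?_⟩
  rw [map_mul, eval_subst] at hne
  obtain ⟨g0, g3, gid⟩ := hG x y t hon (left_ne_zero_of_mul hne)
  obtain ⟨x', y', hon', hval⟩ := G.exists_pt hon g0 g3
  have e : ∀ {p : Poly} {n : ℕ}, p.IsHomogeneous n →
      MvPolynomial.eval (fun j => MvPolynomial.eval (pt x y t) (G.F j)) p =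
      MvPolynomial.eval (pt x y t) (G.F 0) ^ n * MvPolynomial.eval (pt x' y' t) p := by
    intro p n hp
    rw [← eval_mul_of_isHomogeneous hp]
    congr 2
    funext i
    exact hval i
  have hKne := right_ne_zero_of_mul hne
  rw [e hK] at hKne
  obtain ⟨f0, f3, fid⟩ := hF x' y' t hon' (right_ne_zero_of_mul hKne)
  simp only [Rep.eval_comp, e (F.homogeneous _)]
  refine ⟨mul_ne_zero (pow_ne_zero _ g0) f0, by rw [f3]; ring, ?_⟩
  have g0' : (MvPolynomial.eval (pt x y t) (G.F 0) : ℂ) ≠ 0 := by exact_mod_cast g0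
  rw [hval 1, hval 2] at gid
  simp only [pt_one, pt_two] at gid
  push_cast at gid
  have gid' := mul_left_cancel₀ g0' ((by linear_combination gid : _ * (((x' : ℂ) + y' * Complex.I) *
    ((N 1 0).eval (t : ℂ) * (x + y * Complex.I) + (N 1 1).eval (t : ℂ))) =
      _ * ((N 0 0).eval (t : ℂ) * (x + y * Complex.I) + (N 0 1).eval (t : ℂ))))
  simp only [Matrix.mul_apply, Fin.sum_univ_two, eval_add, eval_mul]
  push_cast
  set c := (MvPolynomial.eval (pt x y t) (G.F 0) : ℂ) ^ F.deg
  set u := ((MvPolynomial.eval (pt x' y' t) (F.F 1) : ℝ) : ℂ)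
  set v := ((MvPolynomial.eval (pt x' y' t) (F.F 2) : ℝ) : ℂ)
  set w := ((MvPolynomial.eval (pt x' y' t) (F.F 0) : ℝ) : ℂ)
  set ζ : ℂ := x + y * Complex.I
  linear_combination c * ((N 1 0).eval (t : ℂ) * ζ + (N 1 1).eval (t : ℂ)) * fid
    - c * ((u + v * Complex.I) * (M 1 0).eval (t : ℂ) - w * (M 0 0).eval (t : ℂ)) * gid'

theorem cross_eq {f : DomRat} {F G : Rep} (hF : DomRat.mk F = f) (hG : DomRat.mk G = f)
    {v : Fin 4 → ℝ} (hv : MvPolynomial.eval v quadric = 0) (i j : Fin 4) :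
    MvPolynomial.eval v (F.F i) * MvPolynomial.eval v (G.F j) =
      MvPolynomial.eval v (F.F j) * MvPolynomial.eval v (G.F i) := by
  have := eval_eq_zero_of_mem (DomRat.mk_eq_mk.1 (hF.trans hG.symm) i j) hv
  simpa [sub_eq_zero] using this

/-- The matrix of the Möbius transformation is unique up to scalar. -/
theorem Mob.unique {f : DomRat} {M N : Matrix (Fin 2) (Fin 2) ℂ[X]} (hM : Mob f M)
    (hN : Mob f N) : ∃ c : ℂ[X], c ≠ 0 ∧ M.det • N = c • M := by
  obtain ⟨hM, F, K, k, hFf, hK, hK', hF⟩ := hM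
  obtain ⟨hN, G, L, l, hGf, hL, hL', hG⟩ := hN
  obtain ⟨h0, h1, h2⟩ := coeff_eq_zero_of_generic (hK.mul hL) (mul_notMem_idealS hK' hL')
    (A₀ := M 0 1 * N 1 1 - N 0 1 * M 1 1)
    (A₁ := M 0 0 * N 1 1 + M 0 1 * N 1 0 - N 0 0 * M 1 1 - N 0 1 * M 1 0)
    (A₂ := M 0 0 * N 1 0 - N 0 0 * M 1 0) (by
      intro x y t hon hne
      rw [map_mul] at hne
      obtain ⟨f0, -, hf⟩ := hF x y t hon (left_ne_zero_of_mul hne)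
      obtain ⟨g0, -, hg⟩ := hG x y t hon (right_ne_zero_of_mul hne)
      have e1 := cross_eq hFf hGf hon.eval_quadric 1 0
      have e2 := cross_eq hFf hGf hon.eval_quadric 2 0
      have f0' : (MvPolynomial.eval (pt x y t) (F.F 0) : ℂ) ≠ 0 := by exact_mod_cast f0
      have g0' : (MvPolynomial.eval (pt x y t) (G.F 0) : ℂ) ≠ 0 := by exact_mod_cast g0
      have e1' := congrArg (fun r : ℝ => (r : ℂ)) e1
      have e2' := congrArg (fun r : ℝ => (r : ℂ)) e2
      push_cast at e1' e2'
      refine (mul_eq_zero.1 ?_).resolve_left (mul_ne_zero f0' g0')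
      simp only [eval_add, eval_sub, eval_mul]
      set ζ : ℂ := x + y * Complex.I
      set P := (M 1 0).eval (t : ℂ) * ζ + (M 1 1).eval (t : ℂ)
      set Q := (N 1 0).eval (t : ℂ) * ζ + (N 1 1).eval (t : ℂ)
      linear_combination (-Q * MvPolynomial.eval (pt x y t) (G.F 0)) * hf +
        (P * MvPolynomial.eval (pt x y t) (F.F 0)) * hg + P * Q * (e1' + Complex.I * e2'))
  refine ⟨M 1 1 * N 0 0 - M 0 1 * N 1 0, fun hc => ?_, ?_⟩
  · refine mul_ne_zero hM hN ?_
    rw [Matrix.det_fin_two, Matrix.det_fin_two]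
    linear_combination (N 1 1 * M 0 0 - N 0 1 * M 1 0) * hc -
      (M 1 1 * N 0 1 - M 0 1 * N 1 1) * h2
  · rw [Matrix.det_fin_two]
    refine Matrix.ext fun i j => ?_
    fin_cases i <;> fin_cases j <;> simp
    · linear_combination M 0 1 * h2
    · linear_combination M 0 1 * h1 - M 0 0 * h0
    · linear_combination M 1 1 * h2
    · linear_combination M 1 1 * h1 - M 1 0 * h0

/-- Maps with proportional matrices are equal. -/
theorem Mob.ext {f g : DomRat} {M N : Matrix (Fin 2) (Fin 2) ℂ[X]} (hM : Mob f M)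
    (hN : Mob g N) {c d : ℂ[X]} (hc : c ≠ 0) (h : d • N = c • M) : f = g := by
  obtain ⟨hM, F, K, k, rfl, hK, hK', hF⟩ := hM
  obtain ⟨hN, G, L, l, rfl, hL, hL', hG⟩ := hN
  rw [DomRat.mk_eq_mk]
  intro i j
  refine mem_idealS_of_generic
    (((F.homogeneous i).mul (G.homogeneous j)).sub ((F.homogeneous j).mul (G.homogeneous i)))
    (hK.mul hL) (mul_notMem_idealS hK' hL') (mul_ne_zero hM hc) fun x y t hon hne hδ => ?_
  rw [map_mul] at hne
  obtain ⟨f0, f3, hf⟩ := hF x y t hon (left_ne_zero_of_mul hne)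
  obtain ⟨g0, g3, hg⟩ := hG x y t hon (right_ne_zero_of_mul hne)
  set ζ : ℂ := x + y * Complex.I
  set P := (M 1 0).eval (t : ℂ) * ζ + (M 1 1).eval (t : ℂ) with hP
  set R := (M 0 0).eval (t : ℂ) * ζ + (M 0 1).eval (t : ℂ) with hR
  have f0' : (MvPolynomial.eval (pt x y t) (F.F 0) : ℂ) ≠ 0 := by exact_mod_cast f0
  have hent : ∀ i j, d.eval (t : ℂ) * (N i j).eval (t : ℂ) =
      c.eval (t : ℂ) * (M i j).eval (t : ℂ) := fun i j => by
    have := congrArg (fun A : Matrix (Fin 2) (Fin 2) ℂ[X] => (A i j).eval (t : ℂ)) h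
    simpa using this
  rw [eval_mul] at hδ
  have hc0 := right_ne_zero_of_mul hδ
  have hdet := left_ne_zero_of_mul hδ
  rw [Matrix.det_fin_two] at hdet
  simp only [eval_sub, eval_mul] at hdet
  have hP0 : P ≠ 0 := by
    intro hP0
    rw [hP0, mul_zero] at hf
    have hR0 : R = 0 := (mul_eq_zero.1 hf.symm).resolve_right f0'
    by_cases h10 : (M 1 0).eval (t : ℂ) = 0
    · have h11 : (M 1 1).eval (t : ℂ) = 0 := by rw [hP, h10] at hP0; simpa using hP0
      exact hdet (by rw [h10, h11]; ring)
    · refine hdet ((mul_eq_zero.1 (?_ : (M 1 0).eval (t : ℂ) * _ = 0)).resolve_left h10)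
      rw [hP] at hP0
      rw [hR] at hR0
      linear_combination (M 1 0).eval (t : ℂ) * ((M 0 0).eval (t : ℂ) * hP0 -
        (M 1 0).eval (t : ℂ) * hR0)
  have key : ((MvPolynomial.eval (pt x y t) (F.F 1) : ℂ) +
        MvPolynomial.eval (pt x y t) (F.F 2) * Complex.I) * MvPolynomial.eval (pt x y t) (G.F 0) =
      ((MvPolynomial.eval (pt x y t) (G.F 1) : ℂ) +
        MvPolynomial.eval (pt x y t) (G.F 2) * Complex.I) *
        MvPolynomial.eval (pt x y t) (F.F 0) := by
    refine mul_left_cancel₀ (mul_ne_zero hP0 hc0) ?_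
    linear_combination (c.eval (t : ℂ) * MvPolynomial.eval (pt x y t) (G.F 0)) * hf -
      d.eval (t : ℂ) * MvPolynomial.eval (pt x y t) (F.F 0) * hg +
      ((MvPolynomial.eval (pt x y t) (G.F 1) : ℂ) +
        MvPolynomial.eval (pt x y t) (G.F 2) * Complex.I) *
        MvPolynomial.eval (pt x y t) (F.F 0) * (ζ * hent 1 0 + hent 1 1) -
      (MvPolynomial.eval (pt x y t) (G.F 0) : ℂ) *
        MvPolynomial.eval (pt x y t) (F.F 0) * (ζ * hent 0 0 + hent 0 1)
  have k1 := congrArg Complex.re key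
  have k2 := congrArg Complex.im key
  simp at k1 k2
  have k : ∀ i, MvPolynomial.eval (pt x y t) (F.F i) * MvPolynomial.eval (pt x y t) (G.F 0) =
      MvPolynomial.eval (pt x y t) (G.F i) * MvPolynomial.eval (pt x y t) (F.F 0) := by
    intro i
    fin_cases i
    · exact mul_comm _ _
    · exact k1
    · exact k2
    · change MvPolynomial.eval (pt x y t) (F.F 3) * _ = MvPolynomial.eval (pt x y t) (G.F 3) * _
      rw [f3, g3]; ring
  simp only [map_sub, map_mul]
  refine mul_left_cancel₀ (mul_ne_zero f0 g0) ?_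
  linear_combination (MvPolynomial.eval (pt x y t) (F.F 0) *
    MvPolynomial.eval (pt x y t) (G.F j)) * k i - (MvPolynomial.eval (pt x y t) (F.F 0) *
    MvPolynomial.eval (pt x y t) (G.F i)) * k j

/-! ### The generic point of the complex sphere -/

/-- Real constants in `ℂ[t][ζ]`. -/
def realConst : ℝ →+* ℂ[X][X] := ((C : ℂ[X] →+* ℂ[X][X]).comp C).comp Complex.ofRealHom

/-- Homogeneous coordinates of the generic point of `S` over `ℂ`, scaled by `2 i ζ` so that they are
polynomials in `t` and `ζ`, where `ζ = x + i y` and `x - i y = (1 - t²) / ζ`. -/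
def genericPt : Fin 4 → ℂ[X][X] :=
  ![C (C (2 * Complex.I)) * X, C (C Complex.I) * (X ^ 2 + C (1 - X ^ 2)), X ^ 2 - C (1 - X ^ 2),
    C (C (2 * Complex.I)) * X * C X]

/-- Evaluation of polynomials at the generic point. -/
def evalGeneric : Poly →+* ℂ[X][X] := MvPolynomial.eval₂Hom realConst genericPt

/-- The specialization of the parameters to complex numbers. -/
def specialize (t ζ : ℂ) : ℂ[X][X] →+* ℂ := eval₂RingHom (evalRingHom t) ζ

theorem specialize_evalGeneric {x y t : ℝ} (hon : OnSphere x y t) {p : Poly} {n : ℕ}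
    (hp : p.IsHomogeneous n) :
    specialize t (x + y * Complex.I) (evalGeneric p) =
      (2 * Complex.I * (x + y * Complex.I)) ^ n * MvPolynomial.eval (pt x y t) p := by
  rw [evalGeneric, MvPolynomial.coe_eval₂Hom, MvPolynomial.eval₂_comp_left]
  have h1 : (specialize t (x + y * Complex.I)).comp realConst = Complex.ofRealHom := by
    ext r
    simp [specialize, realConst]
  have hs : (1 : ℂ) - (t : ℂ) ^ 2 = (x : ℂ) ^ 2 + (y : ℂ) ^ 2 := by exact_mod_cast hon.1.symm
  have h2 : (specialize t (x + y * Complex.I)) ∘ genericPt =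
      fun i => 2 * Complex.I * (x + y * Complex.I) * (pt x y t i : ℂ) := by
    funext i
    fin_cases i
    · simp [specialize, genericPt]
    · have : specialize t (x + y * Complex.I) (genericPt 1) =
          Complex.I * ((x + y * Complex.I) ^ 2 + (1 - (t : ℂ) ^ 2)) := by
        simp [specialize, genericPt, -map_sub, -map_pow]
      simp only [Function.comp_apply, Fin.mk_one, this, pt_one, hs]
      linear_combination (y ^ 2 * Complex.I) * Complex.I_sq
    · have : specialize t (x + y * Complex.I) (genericPt 2) =
          (x + y * Complex.I) ^ 2 - (1 - (t : ℂ) ^ 2) := by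
        simp [specialize, genericPt, -map_sub, -map_pow]
      simp only [Function.comp_apply, Fin.reduceFinMk, this, pt_two, hs]
      linear_combination (-y ^ 2) * Complex.I_sq
    · simp [specialize, genericPt]
  rw [h1, h2, eval₂_mul_of_isHomogeneous _ hp]
  congr 1
  exact (MvPolynomial.eval₂_comp_left Complex.ofRealHom (RingHom.id ℝ) (pt x y t) p).symm

theorem OnSphere.zeta_ne_zero {x y t : ℝ} (hon : OnSphere x y t) :
    (x + y * Complex.I : ℂ) ≠ 0 := by
  intro h
  have h1 := congrArg Complex.re h
  have h2 := congrArg Complex.im h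
  simp at h1 h2
  have := hon.1
  rw [h1, h2] at this
  nlinarith [hon.2.1, hon.2.2]

theorem evalGeneric_eq_zero {p : Poly} (hp : p ∈ idealS) : evalGeneric p = 0 := by
  obtain ⟨q, rfl⟩ := Ideal.mem_span_singleton.1 hp
  have h : evalGeneric quadric = 0 := by
    have hI : (C (C Complex.I) : ℂ[X][X]) ^ 2 = -1 := by
      rw [← C_pow, ← C_pow, Complex.I_sq]; simp
    simp only [evalGeneric, quadric, map_sub, map_pow, MvPolynomial.coe_eval₂Hom,
      MvPolynomial.eval₂_X, genericPt, Matrix.cons_val, map_mul, map_ofNat, map_one]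
    linear_combination (4 * X ^ 2 * (1 - C X ^ 2) - (X ^ 2 + (1 - C X ^ 2)) ^ 2) * hI
  rw [map_mul, h, zero_mul]

theorem evalGeneric_ne_zero {p : Poly} {n : ℕ} (hp : p.IsHomogeneous n) (h : p ∉ idealS) :
    evalGeneric p ≠ 0 := by
  obtain ⟨x, y, t, hon, hne⟩ := exists_eval_ne_zero hp h
  intro h0
  have := specialize_evalGeneric hon hp
  rw [h0, map_zero] at this
  exact mul_ne_zero (pow_ne_zero _ (mul_ne_zero (by simp) hon.zeta_ne_zero))
    (Complex.ofReal_ne_zero.2 hne) this.symm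

theorem evalGeneric_subst (F : Fin 4 → Poly) (p : Poly) :
    evalGeneric (subst F p) = MvPolynomial.eval₂ realConst (fun i => evalGeneric (F i)) p := by
  have : evalGeneric.comp (subst F).toRingHom =
      MvPolynomial.eval₂Hom realConst (fun i => evalGeneric (F i)) := by
    apply MvPolynomial.ringHom_ext
    · intro r
      simp [evalGeneric]
    · intro i
      simp
  exact congrArg (fun φ => φ p) this

/-! ### Birational maps over the base are Möbius transformations -/

/-- A generator of the field `k(X)` of rational functions is a quotient of polynomials of degree at
most `1`. -/
theorem exists_mobius_of_adjoin_eq_top {k : Type*} [Field k] (z : RatFunc k)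
    (hz : IntermediateField.adjoin k {z} = ⊤) :
    ∃ a b c d : k, a * d - b * c ≠ 0 ∧
      z * (RatFunc.C c * RatFunc.X + RatFunc.C d) = RatFunc.C a * RatFunc.X + RatFunc.C b := by
  have hmax := RatFunc.finrank_eq_max_natDegree z
  rw [hz, IntermediateField.finrank_top] at hmax
  have hn : z.num.natDegree ≤ 1 := hmax ▸ le_max_left _ _
  have hd : z.denom.natDegree ≤ 1 := hmax ▸ le_max_right _ _
  have hcop := RatFunc.isCoprime_num_denom z
  obtain ⟨a, b, hab⟩ := exists_eq_X_add_C_of_natDegree_le_one hn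
  obtain ⟨c, d, hcd⟩ := exists_eq_X_add_C_of_natDegree_le_one hd
  refine ⟨a, b, c, d, fun h0 => ?_, ?_⟩
  · have e1 : C c * z.num = C a * z.denom := by
      rw [hab, hcd]
      have := congrArg (C : k → k[X]) h0
      simp only [map_sub, map_mul, map_zero] at this
      linear_combination -this
    have hdvd : z.denom ∣ C c := hcop.symm.dvd_of_dvd_mul_right ⟨C a, by rw [e1]; ring⟩
    have hdeg0 : z.denom.natDegree = 0 := by
      by_cases hc : c = 0
      · rw [hcd, hc]; simp
      · simpa using natDegree_le_of_dvd hdvd (C_ne_zero.2 hc)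
    have hc : c = 0 := by
      have := coeff_eq_zero_of_natDegree_lt (p := z.denom) (n := 1) (by omega)
      rw [hcd] at this
      simpa using this
    have hd0 : d ≠ 0 := by
      rintro rfl
      exact z.denom_ne_zero (by rw [hcd, hc]; simp)
    have ha : a = 0 := by
      rw [hc, mul_zero, sub_zero] at h0
      exact (mul_eq_zero.1 h0).resolve_right hd0
    have : z.num.natDegree = 0 := by rw [hab, ha]; simp
    omega
  · have hz' := RatFunc.num_div_denom z
    have hne : algebraMap k[X] (RatFunc k) z.denom ≠ 0 := RatFunc.algebraMap_ne_zero z.denom_ne_zero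
    rw [div_eq_iff hne] at hz'
    have e1 : algebraMap k[X] (RatFunc k) z.num = RatFunc.C a * RatFunc.X + RatFunc.C b := by
      rw [hab]; simp
    have e2 : algebraMap k[X] (RatFunc k) z.denom = RatFunc.C c * RatFunc.X + RatFunc.C d := by
      rw [hcd]; simp
    rw [← e1, ← e2, hz']

section FunctionField

variable {k : Type*} [Field k] [Algebra ℂ[X] k]

/-- The map of `ℂ[t][ζ]` to `k(ζ)`, where `k` is a field with a map `ℂ[t] → k`. -/
def toRatFunc : ℂ[X][X] →+* RatFunc k :=
  (algebraMap k[X] (RatFunc k)).comp (mapRingHom (algebraMap ℂ[X] k))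

theorem toRatFunc_X : (toRatFunc X : RatFunc k) = RatFunc.X := by simp [toRatFunc]

theorem toRatFunc_C (p : ℂ[X]) :
    (toRatFunc (C p) : RatFunc k) = algebraMap k _ (algebraMap ℂ[X] k p) := by
  simp [toRatFunc]

variable [IsFractionRing ℂ[X] k]

theorem toRatFunc_injective : Function.Injective (toRatFunc : ℂ[X][X] →+* RatFunc k) :=
  (RatFunc.algebraMap_injective _).comp (map_injective _ (IsFractionRing.injective ℂ[X] k))

theorem toRatFunc_ne_zero {p : ℂ[X][X]} (hp : p ≠ 0) : (toRatFunc p : RatFunc k) ≠ 0 :=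
  (map_ne_zero_iff _ toRatFunc_injective).2 hp

/-- If a rational map over the base has an inverse, then its complex coordinate generates the
function field `k(ζ)` over `k = ℂ(t)`, because `ζ` is a rational expression in it. -/
theorem adjoin_eq_top {F G : Rep}
    (hF : F.F 0 * MvPolynomial.X 3 - F.F 3 * MvPolynomial.X 0 ∈ idealS)
    (hGF : DomRat.mk (G.comp F) = 1) :
    IntermediateField.adjoin k
      {((toRatFunc (evalGeneric (F.F 1)) + toRatFunc (C (C Complex.I)) *
        toRatFunc (evalGeneric (F.F 2))) / toRatFunc (evalGeneric (F.F 0)) : RatFunc k)} = ⊤ := by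
  set I' : RatFunc k := toRatFunc (C (C Complex.I)) with hI'
  have hII : I' ^ 2 = -1 := by
    rw [hI', ← map_pow, ← C_pow, ← C_pow, Complex.I_sq]; simp
  set e : Fin 4 → RatFunc k := fun i => toRatFunc (evalGeneric (F.F i))
  set T : RatFunc k := toRatFunc (C X) with hT
  set Z : RatFunc k := toRatFunc X with hZ
  have e0 : e 0 ≠ 0 := toRatFunc_ne_zero (evalGeneric_ne_zero (F.homogeneous 0) (F.F_notMem 0))
  have hZ0 : Z ≠ 0 := toRatFunc_ne_zero X_ne_zero
  have hI0 : I' ≠ 0 := fun h => by rw [h] at hII; norm_num at hII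
  have hC2 : (toRatFunc (C (C 2)) : RatFunc k) = 2 := by
    rw [show (C (C 2) : ℂ[X][X]) = 2 from rfl, map_ofNat]
  have h20 : (2 : RatFunc k) ≠ 0 := by
    rw [← hC2]
    exact toRatFunc_ne_zero (C_ne_zero.2 (C_ne_zero.2 two_ne_zero))
  have g0 : toRatFunc (genericPt 0) = 2 * I' * Z := by simp [genericPt, hI', hZ, hC2]
  have g1 : toRatFunc (genericPt 1) = I' * (Z ^ 2 + (1 - T ^ 2)) := by
    simp [genericPt, hI', hZ, hT]
  have g2 : toRatFunc (genericPt 2) = Z ^ 2 - (1 - T ^ 2) := by simp [genericPt, hZ, hT]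
  have g3 : toRatFunc (genericPt 3) = 2 * I' * Z * T := by simp [genericPt, hI', hZ, hT, hC2]
  have hX : ∀ i, evalGeneric (MvPolynomial.X i) = genericPt i := fun i => by simp [evalGeneric]
  have e3 : e 3 = e 0 * T := by
    have := congrArg (toRatFunc : _ →+* RatFunc k) (evalGeneric_eq_zero hF)
    simp only [map_sub, map_mul, hX, g0, g3, map_zero] at this
    refine mul_left_cancel₀ (mul_ne_zero (mul_ne_zero h20 hI0) hZ0) ?_
    linear_combination -this
  have hquad : e 0 ^ 2 - e 1 ^ 2 - e 2 ^ 2 - e 3 ^ 2 = 0 := by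
    have := congrArg (toRatFunc : _ →+* RatFunc k) (evalGeneric_eq_zero F.mapsTo)
    rw [evalGeneric_subst] at this
    simpa [quadric] using this
  set z := (e 1 + I' * e 2) / e 0 with hz
  set E := IntermediateField.adjoin k {z}
  have hzE : z ∈ E := IntermediateField.mem_adjoin_simple_self _ _
  have hCE : ∀ p : ℂ[X], toRatFunc (C p) ∈ E := fun p => by
    rw [toRatFunc_C]; exact E.algebraMap_mem _
  have hIE : I' ∈ E := hCE _
  have hTE : T ∈ E := hCE _
  have h2E : (2 : RatFunc k) ∈ E := by
    have := E.algebraMap_mem 2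
    rwa [map_ofNat] at this
  -- The conjugate coordinate is `(1 - t²) / z`.
  have hzz : z * ((e 1 - I' * e 2) / e 0) = 1 - T ^ 2 := by
    rw [hz]
    field_simp
    rw [e3] at hquad
    linear_combination -e 2 ^ 2 * hII - hquad
  have hT1 : (1 : RatFunc k) - T ^ 2 ≠ 0 := by
    have : toRatFunc (C (1 - X ^ 2)) = 1 - T ^ 2 := by simp [hT]
    rw [← this]
    refine toRatFunc_ne_zero (C_ne_zero.2 fun h => ?_)
    have h2 := congrArg (Polynomial.eval (0 : ℂ)) h
    simp at h2
  have hz0 : z ≠ 0 := fun h => hT1 (by rw [← hzz, h, zero_mul])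
  have hzE' : (e 1 - I' * e 2) / e 0 ∈ E := by
    have : (e 1 - I' * e 2) / e 0 = (1 - T ^ 2) / z := by
      rw [eq_div_iff hz0, ← hzz, mul_comm]
    rw [this]
    exact E.div_mem (E.sub_mem E.one_mem (E.pow_mem hTE 2)) hzE
  have hr : ∀ i, e i / e 0 ∈ E := by
    intro i
    fin_cases i
    · change e 0 / e 0 ∈ E
      rw [div_self e0]
      exact E.one_mem
    · have : e 1 / e 0 = (z + (e 1 - I' * e 2) / e 0) / 2 := by rw [hz]; field_simp; ring
      change e 1 / e 0 ∈ E
      rw [this]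
      exact E.div_mem (E.add_mem hzE hzE') h2E
    · have : e 2 / e 0 = (z - (e 1 - I' * e 2) / e 0) / (2 * I') := by rw [hz]; field_simp; ring
      change e 2 / e 0 ∈ E
      rw [this]
      exact E.div_mem (E.sub_mem hzE hzE') (E.mul_mem h2E hIE)
    · change e 3 / e 0 ∈ E
      rw [e3, mul_div_cancel_left₀ _ e0]
      exact hTE
  let g : Fin 4 → RatFunc k := fun i =>
    MvPolynomial.eval₂ (toRatFunc.comp realConst) (fun j => e j / e 0) (G.F i)
  have hgE : ∀ i, g i ∈ E := fun i => by
    exact MvPolynomial.eval₂_mem (f := toRatFunc.comp realConst) (p := G.F i) (s := E)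
      (fun m _ => hCE _) hr
  have hcomp : ∀ i, toRatFunc (evalGeneric ((G.comp F).F i)) = e 0 ^ G.deg * g i := by
    intro i
    change toRatFunc (evalGeneric (subst F.F (G.F i))) = _
    rw [evalGeneric_subst, MvPolynomial.eval₂_comp_left,
      ← eval₂_mul_of_isHomogeneous _ (G.homogeneous i)]
    congr 1
    funext j
    rw [mul_div_cancel₀ _ e0]
    rfl
  have hgp : ∀ i j, g i * toRatFunc (genericPt j) = g j * toRatFunc (genericPt i) := by
    intro i j
    have h1 : (G.comp F).F i * MvPolynomial.X j - (G.comp F).F j * MvPolynomial.X i ∈ idealS :=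
      DomRat.mk_eq_mk.1 hGF i j
    have := congrArg (toRatFunc : _ →+* RatFunc k) (evalGeneric_eq_zero h1)
    simp only [map_sub, map_mul, hX, hcomp, map_zero] at this
    refine mul_left_cancel₀ (pow_ne_zero G.deg e0) ?_
    linear_combination this
  have hg0 : g 0 ≠ 0 := by
    intro h
    exact toRatFunc_ne_zero (evalGeneric_ne_zero ((G.comp F).homogeneous 0)
      ((G.comp F).F_notMem 0)) (by rw [hcomp, h, mul_zero])
  have hZE : Z ∈ E := by
    have h1 := hgp 1 0
    have h2 := hgp 2 0
    rw [g0, g1] at h1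
    rw [g0, g2] at h2
    have : Z = (g 1 + I' * g 2) / g 0 := by
      rw [eq_div_iff hg0]
      refine mul_left_cancel₀ (mul_ne_zero (mul_ne_zero h20 hI0) hZ0) ?_
      linear_combination -h1 - I' * h2
    rw [this]
    exact E.div_mem (E.add_mem (hgE 1) (E.mul_mem hIE (hgE 2))) (hgE 0)
  rw [eq_top_iff]
  rw [hZ, toRatFunc_X] at hZE
  rw [← RatFunc.adjoin_X, IntermediateField.adjoin_simple_le_iff]
  exact hZE

end FunctionField

theorem OverBase.mem {f : DomRat} (hf : f.OverBase) {F : Rep} (hF : DomRat.mk F = f) :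
    F.F 0 * MvPolynomial.X 3 - F.F 3 * MvPolynomial.X 0 ∈ idealS := by
  obtain ⟨G, hG, h⟩ := hf
  have h1 := DomRat.mk_eq_mk.1 (hF.trans hG.symm) 0 3
  refine mem_of_mul_mem (G.F_notMem 0) ?_
  have h2 := idealS.mul_mem_left (F.F 0) h
  have h3 := idealS.mul_mem_left (MvPolynomial.X 0) h1
  convert idealS.add_mem h2 h3 using 1
  ring

theorem OnSphere.eval_three {x y t : ℝ} (hon : OnSphere x y t) {F : Rep}
    (hF : F.F 0 * MvPolynomial.X 3 - F.F 3 * MvPolynomial.X 0 ∈ idealS) :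
    MvPolynomial.eval (pt x y t) (F.F 3) = t * MvPolynomial.eval (pt x y t) (F.F 0) := by
  have := hon.eval_eq_zero hF
  simp only [map_sub, map_mul, MvPolynomial.eval_X, pt_zero, pt_three] at this
  linarith

/-- Every birational map over the base acts on the circles by Möbius transformations. -/
theorem exists_mob (f : Bir) (hf : f ∈ BirOver) : ∃ M, Mob f M := by
  let K := FractionRing ℂ[X]
  obtain ⟨F, hF⟩ := Quotient.exists_rep (f : DomRat)
  obtain ⟨G, hG⟩ := Quotient.exists_rep ((f⁻¹ : Bir) : DomRat)
  change DomRat.mk F = _ at hF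
  change DomRat.mk G = _ at hG
  have hbase := OverBase.mem hf hF
  have hGF : DomRat.mk (G.comp F) = 1 := by
    rw [← DomRat.mk_mul_mk, hF, hG]
    exact f.inv_mul
  obtain ⟨a, b, c, d, hdet, hid⟩ := exists_mobius_of_adjoin_eq_top _
    (adjoin_eq_top (k := FractionRing ℂ[X]) hbase hGF)
  obtain ⟨⟨δ, hδ⟩, hint⟩ := IsLocalization.exist_integer_multiples (nonZeroDivisors ℂ[X])
    Finset.univ (![a, b, c, d] : Fin 4 → K)
  choose N hN using fun i => hint i (Finset.mem_univ i)
  simp only [Algebra.smul_def] at hN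
  have hδ0 : algebraMap ℂ[X] K δ ≠ 0 :=
    (map_ne_zero_iff _ (IsFractionRing.injective ℂ[X] K)).2 (nonZeroDivisors.ne_zero hδ)
  have hNa : algebraMap ℂ[X] K (N 0) = algebraMap ℂ[X] K δ * a := hN 0
  have hNb : algebraMap ℂ[X] K (N 1) = algebraMap ℂ[X] K δ * b := hN 1
  have hNc : algebraMap ℂ[X] K (N 2) = algebraMap ℂ[X] K δ * c := hN 2
  have hNd : algebraMap ℂ[X] K (N 3) = algebraMap ℂ[X] K δ * d := hN 3
  have e0 : (toRatFunc (evalGeneric (F.F 0)) : RatFunc K) ≠ 0 :=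
    toRatFunc_ne_zero (evalGeneric_ne_zero (F.homogeneous 0) (F.F_notMem 0))
  have hpoly : (evalGeneric (F.F 1) + C (C Complex.I) * evalGeneric (F.F 2)) *
      (C (N 2) * X + C (N 3)) = (C (N 0) * X + C (N 1)) * evalGeneric (F.F 0) := by
    apply toRatFunc_injective (k := K)
    simp only [map_mul, map_add]
    rw [div_mul_eq_mul_div, div_eq_iff e0] at hid
    simp only [toRatFunc_C (N _), toRatFunc_X, hNa, hNb, hNc, hNd, map_mul,
      RatFunc.algebraMap_eq_C]
    linear_combination (RatFunc.C (algebraMap ℂ[X] K δ)) * hid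
  refine ⟨!![N 0, N 1; N 2, N 3], ?_, F, F.F 0, F.deg, hF, F.homogeneous 0, F.F_notMem 0, ?_⟩
  · rw [Matrix.det_fin_two_of]
    intro h
    have := congrArg (algebraMap ℂ[X] K) h
    simp only [map_sub, map_mul, hNa, hNb, hNc, hNd, map_zero] at this
    refine mul_ne_zero (pow_ne_zero 2 hδ0) hdet ?_
    linear_combination this
  · intro x y t hon hne
    refine ⟨hne, hon.eval_three hbase, ?_⟩
    have h1 := congrArg (specialize t (x + y * Complex.I)) hpoly
    simp only [map_mul, map_add, specialize_evalGeneric hon (F.homogeneous _)] at h1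
    have h2 : ∀ p : ℂ[X], specialize t (x + y * Complex.I) (C p) = p.eval (t : ℂ) := fun p => by
      simp [specialize]
    have h3 : specialize t (x + y * Complex.I) X = x + y * Complex.I := by simp [specialize]
    simp only [h2, h3, eval_C] at h1
    simp only [Matrix.of_apply, Matrix.cons_val', Matrix.cons_val_zero, Matrix.cons_val_one,
      Matrix.cons_val_fin_one]
    refine mul_left_cancel₀ (pow_ne_zero F.deg
      (mul_ne_zero (mul_ne_zero two_ne_zero Complex.I_ne_zero) hon.zeta_ne_zero)) ?_
    linear_combination h1

/-! ### Reflections -/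

/-- The homogenization `w ^ N * p (z / w)` of a polynomial `p` of degree at most `N`. -/
def homog (N : ℕ) (p : ℝ[X]) : Poly :=
  ∑ i ∈ Finset.range (N + 1),
    MvPolynomial.C (p.coeff i) * (MvPolynomial.X 3 ^ i * MvPolynomial.X 0 ^ (N - i))

theorem homog_isHomogeneous (N : ℕ) (p : ℝ[X]) : (homog N p).IsHomogeneous N := by
  refine MvPolynomial.IsHomogeneous.sum _ _ _ fun i hi => ?_
  have h := ((MvPolynomial.isHomogeneous_X_pow (R := ℝ) (3 : Fin 4) i).mul
    (MvPolynomial.isHomogeneous_X_pow (R := ℝ) (0 : Fin 4) (N - i)))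
  rw [Nat.add_sub_cancel' (Nat.lt_succ_iff.1 (Finset.mem_range.1 hi))] at h
  simpa using (MvPolynomial.isHomogeneous_C (Fin 4) (p.coeff i)).mul h

theorem eval_homog {N : ℕ} {p : ℝ[X]} (hp : p.natDegree ≤ N) (x y t : ℝ) :
    MvPolynomial.eval (pt x y t) (homog N p) = p.eval t := by
  rw [eval_eq_sum_range' (Nat.lt_succ_iff.2 hp)]
  simp [homog]

/-- A vector `v = (e a, e b, c)` of polynomials in `t` for the quadratic form
`x² + y² - (1 - t²) w²`, where `1 - t² = e e'`. The linear form `Λ = a x + b y - e' c w` is the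
polar form of `v` divided by `e`, and its value `Q = e (a² + b²) - e' c²` at `v` is required to be
nonzero. Two values of `e` are used: `e = 1`, and `e = 1 - t²` for vectors which become isotropic at
the poles, where the common factor `1 - t²` has to be removed. -/
structure ReflData where
  e : ℝ[X]
  e' : ℝ[X]
  a : ℝ[X]
  b : ℝ[X]
  c : ℝ[X]
  mul_eq : e * e' = 1 - X ^ 2
  ne_zero : e * (a ^ 2 + b ^ 2) - e' * c ^ 2 ≠ 0

namespace ReflData

variable (d : ReflData)

/-- The value `Λ(v)`. -/
def Q : ℝ[X] := d.e * (d.a ^ 2 + d.b ^ 2) - d.e' * d.c ^ 2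

theorem Q_ne_zero : d.Q ≠ 0 := d.ne_zero

/-- The matrix of `u ↦ Q u - 2 Λ(u) v`, a multiple of the reflection in `v`, in the
coordinates `(w, x, y)`. -/
def mat : Matrix (Fin 3) (Fin 3) ℝ[X] :=
  !![d.e * (d.a ^ 2 + d.b ^ 2) + d.e' * d.c ^ 2, -2 * d.c * d.a, -2 * d.c * d.b;
    2 * d.e * d.e' * d.a * d.c, d.Q - 2 * d.e * d.a ^ 2, -2 * d.e * d.a * d.b;
    2 * d.e * d.e' * d.b * d.c, -2 * d.e * d.a * d.b, d.Q - 2 * d.e * d.b ^ 2]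

/-- A bound for the degrees of the entries of the matrix. -/
def bound : ℕ := Finset.univ.sup fun p : Fin 3 × Fin 3 => (d.mat p.1 p.2).natDegree

theorem natDegree_le (i j : Fin 3) : (d.mat i j).natDegree ≤ d.bound :=
  Finset.le_sup (f := fun p : Fin 3 × Fin 3 => (d.mat p.1 p.2).natDegree)
    (Finset.mem_univ (i, j))

/-- The rows of the matrix as homogeneous polynomials. -/
def row (i : Fin 3) : Poly :=
  homog d.bound (d.mat i 0) * MvPolynomial.X 0 + homog d.bound (d.mat i 1) * MvPolynomial.X 1 +
    homog d.bound (d.mat i 2) * MvPolynomial.X 2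

theorem row_isHomogeneous (i : Fin 3) : (d.row i).IsHomogeneous (d.bound + 1) :=
  (((homog_isHomogeneous _ _).mul (MvPolynomial.isHomogeneous_X _ _)).add
    ((homog_isHomogeneous _ _).mul (MvPolynomial.isHomogeneous_X _ _))).add
    ((homog_isHomogeneous _ _).mul (MvPolynomial.isHomogeneous_X _ _))

/-- Homogeneous coordinates of the reflection. -/
def coords : Fin 4 → Poly :=
  ![MvPolynomial.X 0 * d.row 0, MvPolynomial.X 0 * d.row 1, MvPolynomial.X 0 * d.row 2,
    MvPolynomial.X 3 * d.row 0]

theorem coords_isHomogeneous (i : Fin 4) : (d.coords i).IsHomogeneous (1 + (d.bound + 1)) := by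
  fin_cases i <;> exact (MvPolynomial.isHomogeneous_X _ _).mul (d.row_isHomogeneous _)

theorem eval_row (i : Fin 3) (x y t : ℝ) : MvPolynomial.eval (pt x y t) (d.row i) =
    (d.mat i 0).eval t + (d.mat i 1).eval t * x + (d.mat i 2).eval t * y := by
  simp [row, eval_homog (d.natDegree_le _ _)]

/-- The value at `t` of `Λ` at `(x, y, 1)`. -/
def lam (x y t : ℝ) : ℝ := d.a.eval t * x + d.b.eval t * y - d.e'.eval t * d.c.eval t

theorem eval_coords_zero (x y t : ℝ) : MvPolynomial.eval (pt x y t) (d.coords 0) =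
    d.Q.eval t - 2 * d.lam x y t * d.c.eval t := by
  simp [coords, eval_row, mat, lam, Q]
  ring

theorem eval_coords_one (x y t : ℝ) : MvPolynomial.eval (pt x y t) (d.coords 1) =
    d.Q.eval t * x - 2 * d.lam x y t * (d.e.eval t * d.a.eval t) := by
  simp [coords, eval_row, mat, lam, Q]
  ring

theorem eval_coords_two (x y t : ℝ) : MvPolynomial.eval (pt x y t) (d.coords 2) =
    d.Q.eval t * y - 2 * d.lam x y t * (d.e.eval t * d.b.eval t) := by
  simp [coords, eval_row, mat, lam, Q]
  ring

theorem eval_coords_three (x y t : ℝ) : MvPolynomial.eval (pt x y t) (d.coords 3) =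
    t * MvPolynomial.eval (pt x y t) (d.coords 0) := by
  simp [coords]

theorem eval_mul_eq (t : ℝ) : d.e.eval t * d.e'.eval t = 1 - t ^ 2 := by
  simpa using congrArg (Polynomial.eval t) d.mul_eq

theorem eval_Q (t : ℝ) : d.Q.eval t =
    d.e.eval t * (d.a.eval t ^ 2 + d.b.eval t ^ 2) - d.e'.eval t * d.c.eval t ^ 2 := by
  simp [Q]

/-- The reflection preserves the circles. -/
theorem eval_coords_sq {x y t : ℝ} (h : x ^ 2 + y ^ 2 = 1 - t ^ 2) :
    MvPolynomial.eval (pt x y t) (d.coords 1) ^ 2 + MvPolynomial.eval (pt x y t) (d.coords 2) ^ 2 =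
      (1 - t ^ 2) * MvPolynomial.eval (pt x y t) (d.coords 0) ^ 2 := by
  rw [eval_coords_zero, eval_coords_one, eval_coords_two]
  have h1 := d.eval_mul_eq t
  have h2 := d.eval_Q t
  simp only [lam]
  rw [← h1] at h ⊢
  rw [h2]
  linear_combination (d.e.eval t * (d.a.eval t ^ 2 + d.b.eval t ^ 2) -
    d.e'.eval t * d.c.eval t ^ 2) ^ 2 * h

/-- Outside the zeros of `Q` the first coordinate of the reflection does not vanish. -/
theorem eval_coords_zero_ne_zero {x y t : ℝ} (h : x ^ 2 + y ^ 2 = 1 - t ^ 2)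
    (hQ : d.Q.eval t ≠ 0) : MvPolynomial.eval (pt x y t) (d.coords 0) ≠ 0 := by
  intro h0
  have hsq := d.eval_coords_sq h
  rw [h0] at hsq
  have h1 : MvPolynomial.eval (pt x y t) (d.coords 1) = 0 := by
    nlinarith [sq_nonneg (MvPolynomial.eval (pt x y t) (d.coords 1)),
      sq_nonneg (MvPolynomial.eval (pt x y t) (d.coords 2))]
  have h2 : MvPolynomial.eval (pt x y t) (d.coords 2) = 0 := by
    nlinarith [sq_nonneg (MvPolynomial.eval (pt x y t) (d.coords 1)),
      sq_nonneg (MvPolynomial.eval (pt x y t) (d.coords 2))]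
  rw [eval_coords_zero] at h0
  rw [eval_coords_one] at h1
  rw [eval_coords_two] at h2
  have hq := d.eval_Q t
  have hl : d.Q.eval t * d.lam x y t = 0 := by
    simp only [lam] at h0 h1 h2 ⊢
    linear_combination (-d.a.eval t) * h1 - d.b.eval t * h2 + d.e'.eval t * d.c.eval t * h0 +
      2 * (d.a.eval t * x + d.b.eval t * y - d.e'.eval t * d.c.eval t) * hq
  have hl' := (mul_eq_zero.1 hl).resolve_left hQ
  rw [hl'] at h0
  exact hQ (by simpa using h0)

/-- Applying the reflection twice multiplies homogeneous coordinates by a scalar. -/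
theorem exists_preimage {x y t : ℝ} (hon : OnSphere x y t) (hQ : d.Q.eval t ≠ 0) :
    ∃ x' y' r, OnSphere x' y' t ∧ r ≠ 0 ∧
      ∀ i, MvPolynomial.eval (pt x' y' t) (d.coords i) = r * pt x y t i := by
  have h0 := d.eval_coords_zero_ne_zero hon.1 hQ
  have hsq := d.eval_coords_sq hon.1
  set g0 := MvPolynomial.eval (pt x y t) (d.coords 0) with hg0
  set g1 := MvPolynomial.eval (pt x y t) (d.coords 1) with hg1
  set g2 := MvPolynomial.eval (pt x y t) (d.coords 2) with hg2
  rw [eval_coords_zero] at hg0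
  rw [eval_coords_one] at hg1
  rw [eval_coords_two] at hg2
  have hl : d.lam (g1 / g0) (g2 / g0) t * g0 = -d.Q.eval t * d.lam x y t := by
    simp only [lam] at hg0 hg1 hg2 ⊢
    have hq := d.eval_Q t
    field_simp
    linear_combination d.a.eval t * hg1 + d.b.eval t * hg2 - d.e'.eval t * d.c.eval t * hg0 +
      2 * (d.a.eval t * x + d.b.eval t * y - d.e'.eval t * d.c.eval t) * hq
  have e0 : MvPolynomial.eval (pt (g1 / g0) (g2 / g0) t) (d.coords 0) = d.Q.eval t ^ 2 / g0 := by
    rw [eval_coords_zero, eq_div_iff h0]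
    linear_combination (-2 * d.c.eval t) * hl + d.Q.eval t * hg0
  refine ⟨g1 / g0, g2 / g0, d.Q.eval t ^ 2 / g0, ⟨?_, hon.2⟩,
    div_ne_zero (pow_ne_zero 2 hQ) h0, fun i => ?_⟩
  · field_simp
    linear_combination hsq
  · fin_cases i
    · simpa using e0
    · refine mul_right_cancel₀ h0 ?_
      simp only [Fin.mk_one, eval_coords_one, pt_one]
      rw [div_mul_eq_mul_div, div_mul_cancel₀ _ h0]
      have : g1 / g0 * g0 = g1 := div_mul_cancel₀ _ h0
      linear_combination (-2 * d.e.eval t * d.a.eval t) * hl + d.Q.eval t * hg1 +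
        d.Q.eval t * this
    · refine mul_right_cancel₀ h0 ?_
      simp only [Fin.reduceFinMk, eval_coords_two, pt_two]
      rw [div_mul_eq_mul_div, div_mul_cancel₀ _ h0]
      have : g2 / g0 * g0 = g2 := div_mul_cancel₀ _ h0
      linear_combination (-2 * d.e.eval t * d.b.eval t) * hl + d.Q.eval t * hg2 +
        d.Q.eval t * this
    · simp only [Fin.reduceFinMk, eval_coords_three, pt_three]
      rw [e0, mul_comm]

theorem eval_ofReal (p : ℝ[X]) (t : ℝ) :
    (p.map Complex.ofRealHom).eval (t : ℂ) = ((p.eval t : ℝ) : ℂ) := by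
  rw [eval_map]
  exact eval₂_at_apply Complex.ofRealHom t

theorem map_ofReal_ne_zero {p : ℝ[X]} (hp : p ≠ 0) : p.map Complex.ofRealHom ≠ 0 :=
  (Polynomial.map_ne_zero_iff Complex.ofRealHom.injective).2 hp

/-- The reflection in `v` as a dominant rational map. -/
def rep : Rep where
  deg := 1 + (d.bound + 1)
  F := d.coords
  homogeneous := d.coords_isHomogeneous
  mapsTo := by
    have hq : quadric.IsHomogeneous 2 :=
      (((MvPolynomial.isHomogeneous_X_pow _ 2).sub (MvPolynomial.isHomogeneous_X_pow _ 2)).sub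
        (MvPolynomial.isHomogeneous_X_pow _ 2)).sub (MvPolynomial.isHomogeneous_X_pow _ 2)
    refine mem_idealS_of_eval (hq.aeval _ d.coords_isHomogeneous) fun x y t hon => ?_
    rw [eval_subst, eval_quadric, eval_coords_three]
    linear_combination -d.eval_coords_sq hon.1
  dominant := fun p n hp h => by
    refine mem_idealS_of_generic hp (MvPolynomial.isHomogeneous_X ℝ 0) (X_notMem_idealS 0)
      (map_ofReal_ne_zero d.ne_zero) fun x y t hon _ hδ => ?_
    change (d.Q.map Complex.ofRealHom).eval (t : ℂ) ≠ 0 at hδ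
    rw [eval_ofReal, Complex.ofReal_ne_zero] at hδ
    obtain ⟨x', y', r, hon', hr, hval⟩ := d.exists_preimage hon hδ
    have := hon'.eval_eq_zero h
    simp only [eval_subst, hval] at this
    rw [eval_mul_of_isHomogeneous hp] at this
    exact (mul_eq_zero.1 this).resolve_left (pow_ne_zero _ hr)

/-- The complex polynomial `a + i b`. -/
def m : ℂ[X] := d.a.map Complex.ofRealHom + C Complex.I * d.b.map Complex.ofRealHom

/-- The complex polynomial `a - i b`. -/
def mbar : ℂ[X] := d.a.map Complex.ofRealHom - C Complex.I * d.b.map Complex.ofRealHom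

/-- The matrix of the Möbius transformation by which the reflection acts on the circles. -/
def mob : Matrix (Fin 2) (Fin 2) ℂ[X] :=
  !![(d.e' * d.c).map Complex.ofRealHom, -((1 - X ^ 2) * d.m);
    d.mbar, -(d.e' * d.c).map Complex.ofRealHom]

theorem m_mul_mbar : d.m * d.mbar = (d.a ^ 2 + d.b ^ 2).map Complex.ofRealHom := by
  have hI : (C Complex.I : ℂ[X]) ^ 2 = -1 := by rw [← C_pow, Complex.I_sq]; simp
  simp only [m, mbar, Polynomial.map_add, Polynomial.map_pow]
  linear_combination (-(d.b.map Complex.ofRealHom) ^ 2) * hI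

theorem map_mul_eq : d.e.map Complex.ofRealHom * d.e'.map Complex.ofRealHom = 1 - X ^ 2 := by
  rw [← Polynomial.map_mul, d.mul_eq]
  simp

theorem det_mob : d.mob.det = (d.e' * d.Q).map Complex.ofRealHom := by
  rw [mob, Matrix.det_fin_two_of, Q]
  have h1 := d.m_mul_mbar
  have h2 := d.map_mul_eq
  simp only [Polynomial.map_mul, Polynomial.map_sub, Polynomial.map_add,
    Polynomial.map_pow] at h1 ⊢
  linear_combination (1 - X ^ 2) * h1 - (d.a.map Complex.ofRealHom ^ 2 +
    d.b.map Complex.ofRealHom ^ 2) * h2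

theorem e'_ne_zero : d.e' ≠ 0 := by
  intro h
  have := congrArg (Polynomial.eval 0) d.mul_eq
  simp [h] at this

theorem det_mob_ne_zero : d.mob.det ≠ 0 := by
  rw [det_mob]
  exact map_ofReal_ne_zero (mul_ne_zero d.e'_ne_zero d.ne_zero)

/-- The reflection in `v`, as a rational map of `S`. -/
def refl : DomRat := DomRat.mk d.rep

theorem mob_refl : Mob d.refl d.mob := by
  refine ⟨d.det_mob_ne_zero, d.rep, d.coords 0, _, rfl, d.coords_isHomogeneous 0,
    d.rep.F_notMem 0, fun x y t hon hne => ⟨hne, d.eval_coords_three x y t, ?_⟩⟩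
  change ((MvPolynomial.eval (pt x y t) (d.coords 1) : ℂ) +
    (MvPolynomial.eval (pt x y t) (d.coords 2) : ℂ) * Complex.I) * _ =
      _ * (MvPolynomial.eval (pt x y t) (d.coords 0) : ℂ)
  rw [eval_coords_zero, eval_coords_one, eval_coords_two, eval_Q]
  have hs : ((d.e.eval t : ℝ) : ℂ) * ((d.e'.eval t : ℝ) : ℂ) = x ^ 2 + y ^ 2 := by
    exact_mod_cast (d.eval_mul_eq t).trans hon.1.symm
  have hs' : (1 : ℂ) - t ^ 2 = x ^ 2 + y ^ 2 := by exact_mod_cast hon.1.symm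
  have hI : Complex.I ^ 2 = -1 := Complex.I_sq
  simp only [mob, m, mbar, lam, Matrix.of_apply, Matrix.cons_val', Matrix.cons_val_zero,
    Matrix.cons_val_one, Matrix.cons_val_fin_one, eval_mul, eval_sub, eval_add, eval_neg,
    eval_ofReal, eval_C, eval_pow, eval_X, eval_one, hs']
  push_cast
  generalize ((d.a.eval t : ℝ) : ℂ) = a
  generalize ((d.b.eval t : ℝ) : ℂ) = b
  generalize ((d.c.eval t : ℝ) : ℂ) = c
  generalize ((d.e.eval t : ℝ) : ℂ) = e at hs ⊢
  generalize ((d.e'.eval t : ℝ) : ℂ) = f at hs ⊢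
  linear_combination (-2 * (e * (a ^ 2 + b ^ 2) - f * c ^ 2) * (x + y * Complex.I) * b * y +
    (e * (a ^ 2 + b ^ 2) - f * c ^ 2) * (a + Complex.I * b) * y ^ 2 +
    2 * (a * x + b * y - f * c) * (x + y * Complex.I) * e * b ^ 2) * hI +
    2 * (a * x + b * y - f * c) * (a + Complex.I * b) * c * hs

theorem refl_mul_refl : d.refl * d.refl = 1 := by
  refine (Mob.ext Mob.one (d.mob_refl.mul d.mob_refl) (c := -d.mob.det) (d := 1)
    (neg_ne_zero.2 d.det_mob_ne_zero) ?_).symm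
  rw [one_smul, mob, Matrix.det_fin_two_of, Matrix.mul_fin_two, Matrix.one_fin_two]
  ext i j : 1
  fin_cases i <;> fin_cases j <;> simp <;> ring

/-- The reflection in `v`, as an element of `Bir(S)`. -/
def unit : Bir := ⟨d.refl, d.refl, d.refl_mul_refl, d.refl_mul_refl⟩

theorem unit_mem_birOver : d.unit ∈ BirOver := by
  refine ⟨d.rep, rfl, ?_⟩
  have : d.rep.F 0 * MvPolynomial.X 3 - d.rep.F 3 * MvPolynomial.X 0 = 0 := by
    simp [rep, coords]
    ring
  rw [this]
  exact idealS.zero_mem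

theorem unit_mem_autRealOver (hQ : ∀ t ∈ Set.Icc (-1 : ℝ) 1, d.Q.eval t ≠ 0) :
    d.unit ∈ AutRealOver := by
  have key : ∀ v, IsRealPoint v → d.refl.DefinedAt v := by
    intro v hv
    have hq := hv.2
    rw [eval_quadric] at hq
    have hv0 : v 0 ≠ 0 := by
      intro h0
      rw [h0] at hq
      refine hv.1 (funext fun i => ?_)
      have h1 := sq_nonneg (v 1)
      have h2 := sq_nonneg (v 2)
      have h3 := sq_nonneg (v 3)
      fin_cases i
      · exact h0
      · exact pow_eq_zero_iff two_ne_zero |>.1 (by linarith : v 1 ^ 2 = 0)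
      · exact pow_eq_zero_iff two_ne_zero |>.1 (by linarith : v 2 ^ 2 = 0)
      · exact pow_eq_zero_iff two_ne_zero |>.1 (by linarith : v 3 ^ 2 = 0)
    have hon : (v 1 / v 0) ^ 2 + (v 2 / v 0) ^ 2 = 1 - (v 3 / v 0) ^ 2 := by
      field_simp
      linarith
    have ht : v 3 / v 0 ∈ Set.Icc (-1 : ℝ) 1 := by
      have : (v 3 / v 0) ^ 2 ≤ 1 := by
        nlinarith [sq_nonneg (v 1 / v 0), sq_nonneg (v 2 / v 0)]
      exact abs_le.1 (by simpa using this)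
    refine ⟨d.rep, rfl, 0, ?_⟩
    have hv' : v = fun i => v 0 * pt (v 1 / v 0) (v 2 / v 0) (v 3 / v 0) i := by
      funext i
      fin_cases i <;> simp [mul_div_cancel₀ _ hv0]
    rw [hv', eval_mul_of_isHomogeneous (d.rep.homogeneous 0)]
    exact mul_ne_zero (pow_ne_zero _ hv0) (d.eval_coords_zero_ne_zero hon (hQ _ ht))
  exact ⟨fun v hv => ⟨key v hv, key v hv⟩, d.unit_mem_birOver⟩

end ReflData

/-! ### Involutions are reflections -/

/-- Complex conjugation of the coefficients. -/
def conj (p : ℂ[X]) : ℂ[X] := p.map (starRingEnd ℂ)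

@[simp] theorem conj_add (p q : ℂ[X]) : conj (p + q) = conj p + conj q := Polynomial.map_add _

@[simp] theorem conj_sub (p q : ℂ[X]) : conj (p - q) = conj p - conj q := Polynomial.map_sub _

@[simp] theorem conj_neg (p : ℂ[X]) : conj (-p) = -conj p := Polynomial.map_neg _

@[simp] theorem conj_mul (p q : ℂ[X]) : conj (p * q) = conj p * conj q := Polynomial.map_mul _

@[simp] theorem conj_pow (p : ℂ[X]) (n : ℕ) : conj (p ^ n) = conj p ^ n := Polynomial.map_pow _ _

@[simp] theorem conj_one : conj 1 = 1 := Polynomial.map_one _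

@[simp] theorem conj_X : conj X = X := Polynomial.map_X _

@[simp] theorem conj_C (z : ℂ) : conj (C z) = C (starRingEnd ℂ z) := Polynomial.map_C _

@[simp] theorem conj_conj (p : ℂ[X]) : conj (conj p) = p := by
  ext i
  simp [conj]

@[simp] theorem conj_map_ofReal (p : ℝ[X]) :
    conj (p.map Complex.ofRealHom) = p.map Complex.ofRealHom := by
  ext i
  simp [conj]

theorem eval_conj (p : ℂ[X]) (t : ℝ) :
    (conj p).eval (t : ℂ) = starRingEnd ℂ (p.eval (t : ℂ)) := by
  rw [conj, eval_map, ← Complex.conj_ofReal, eval₂_at_apply, Complex.conj_ofReal]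

theorem exists_re_im (p : ℂ[X]) : ∃ a b : ℝ[X],
    p = a.map Complex.ofRealHom + C Complex.I * b.map Complex.ofRealHom := by
  induction p using Polynomial.induction_on' with
  | add p q hp hq =>
    obtain ⟨a, b, rfl⟩ := hp
    obtain ⟨a', b', rfl⟩ := hq
    refine ⟨a + a', b + b', ?_⟩
    simp only [Polynomial.map_add]
    ring
  | monomial n z =>
    refine ⟨monomial n z.re, monomial n z.im, ?_⟩
    simp only [map_monomial, C_mul_monomial, ← map_add]
    congr 1
    simpa [mul_comm] using (Complex.re_add_im z).symm

theorem exists_real_of_conj_eq {p : ℂ[X]} (hp : conj p = p) :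
    ∃ a : ℝ[X], p = a.map Complex.ofRealHom := by
  obtain ⟨a, b, rfl⟩ := exists_re_im p
  refine ⟨a, ?_⟩
  simp only [conj_add, conj_mul, conj_C, Complex.conj_I, conj_map_ofReal, C_neg] at hp
  have h2 : (2 : ℂ[X]) * (C Complex.I * b.map Complex.ofRealHom) = 0 := by
    linear_combination -hp
  rw [(mul_eq_zero.1 h2).resolve_left two_ne_zero, add_zero]

/-- The conditions on the matrix which express that the map is defined over `ℝ`. -/
theorem Mob.real {f : DomRat} {M : Matrix (Fin 2) (Fin 2) ℂ[X]} (hM : Mob f M) :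
    M 0 0 * conj (M 0 1) = (1 - X ^ 2) * M 1 0 * conj (M 1 1) ∧
    (1 - X ^ 2) * (M 0 0 * conj (M 0 0)) + M 0 1 * conj (M 0 1) =
      (1 - X ^ 2) * ((1 - X ^ 2) * (M 1 0 * conj (M 1 0)) + M 1 1 * conj (M 1 1)) := by
  obtain ⟨-, F, K, k, -, hK, hK', hF⟩ := hM
  have := coeff_eq_zero_of_generic hK hK'
    (A₀ := (1 - X ^ 2) * (M 0 1 * conj (M 0 0) - (1 - X ^ 2) * M 1 1 * conj (M 1 0)))
    (A₁ := (1 - X ^ 2) * (M 0 0 * conj (M 0 0)) + M 0 1 * conj (M 0 1) -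
      (1 - X ^ 2) * ((1 - X ^ 2) * (M 1 0 * conj (M 1 0)) + M 1 1 * conj (M 1 1)))
    (A₂ := M 0 0 * conj (M 0 1) - (1 - X ^ 2) * M 1 0 * conj (M 1 1)) (by
      intro x y t hon hne
      obtain ⟨f0, f3, hf⟩ := hF x y t hon hne
      have hq := hon.eval_eq_zero F.mapsTo
      rw [eval_subst, eval_quadric, f3] at hq
      have f0' : (MvPolynomial.eval (pt x y t) (F.F 0) : ℂ) ≠ 0 := by exact_mod_cast f0
      have hq' := congrArg (fun r : ℝ => (r : ℂ)) hq
      push_cast at hq'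
      have hs : (1 : ℂ) - t ^ 2 = (x + y * Complex.I) * (x - y * Complex.I) := by
        have : (1 : ℂ) - t ^ 2 = x ^ 2 + y ^ 2 := by exact_mod_cast hon.1.symm
        rw [this]
        linear_combination (y ^ 2 : ℂ) * Complex.I_sq
      have hf' := congrArg (starRingEnd ℂ) hf
      simp only [map_mul, map_add, Complex.conj_I, Complex.conj_ofReal] at hf'
      simp only [eval_add, eval_sub, eval_mul, eval_conj, eval_one, eval_pow, eval_X]
      refine (mul_eq_zero.1 ?_).resolve_left (pow_ne_zero 2 f0')
      generalize (MvPolynomial.eval (pt x y t) (F.F 0) : ℂ) = w at *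
      generalize (MvPolynomial.eval (pt x y t) (F.F 1) : ℂ) = u at *
      generalize (MvPolynomial.eval (pt x y t) (F.F 2) : ℂ) = v at *
      generalize (M 0 0).eval (t : ℂ) = A at *
      generalize (M 0 1).eval (t : ℂ) = B at *
      generalize (M 1 0).eval (t : ℂ) = C at *
      generalize (M 1 1).eval (t : ℂ) = D at *
      set ζ : ℂ := x + y * Complex.I
      set ζ' : ℂ := x - y * Complex.I
      set P := C * ζ + D
      set P' := starRingEnd ℂ C * ζ' + starRingEnd ℂ D
      set R' := starRingEnd ℂ A * ζ' + starRingEnd ℂ B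
      have hf'' : (u - v * Complex.I) * P' = R' * w := by
        linear_combination hf'
      linear_combination (-ζ * (u + v * Complex.I) * P) * hf'' - ζ * R' * w * hf -
        ζ * P * P' * (hq' + v ^ 2 * Complex.I_sq) + w ^ 2 * (A * starRingEnd ℂ A * ζ +
        B * starRingEnd ℂ A - (1 - t ^ 2) * (C * starRingEnd ℂ C * ζ + D * starRingEnd ℂ C)) * hs)
  exact ⟨sub_eq_zero.1 this.2.2, sub_eq_zero.1 this.2.1⟩

/-- The matrix of an involution has trace zero. -/
theorem Mob.trace_eq_zero {f : DomRat} {M : Matrix (Fin 2) (Fin 2) ℂ[X]} (hM : Mob f M)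
    (hf : f * f = 1) (hf1 : f ≠ 1) : M 1 1 = -M 0 0 := by
  obtain ⟨c, hc, h⟩ := Mob.one.unique (hf ▸ hM.mul hM)
  rw [Matrix.det_one, one_smul] at h
  have h00 := congrFun (congrFun h 0) 0
  have h01 := congrFun (congrFun h 0) 1
  have h10 := congrFun (congrFun h 1) 0
  have h11 := congrFun (congrFun h 1) 1
  simp [Matrix.mul_apply, Fin.sum_univ_two] at h00 h01 h10 h11
  by_contra hne
  have htr : M 0 0 + M 1 1 ≠ 0 := fun h0 => hne (by linear_combination h0)
  have b0 : M 0 1 = 0 := (mul_eq_zero.1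
    (by linear_combination h01 : M 0 1 * (M 0 0 + M 1 1) = 0)).resolve_right htr
  have c0 : M 1 0 = 0 := (mul_eq_zero.1
    (by linear_combination h10 : M 1 0 * (M 0 0 + M 1 1) = 0)).resolve_right htr
  have d0 : M 0 0 - M 1 1 = 0 := (mul_eq_zero.1
    (by linear_combination h00 - h11 : (M 0 0 - M 1 1) * (M 0 0 + M 1 1) = 0)).resolve_right htr
  refine hf1 (Mob.ext Mob.one hM (c := M 0 0) (d := 1) (fun h0 => ?_) ?_).symm
  · exact hM.det_ne_zero (by rw [Matrix.det_fin_two, h0, b0]; ring)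
  · rw [one_smul]
    refine Matrix.ext fun i j => ?_
    fin_cases i <;> fin_cases j <;> simp [b0, c0]
    linear_combination -d0

/-- A matrix of trace zero which satisfies the reality conditions is proportional to the
matrix of a reflection, unless the vector `(a, b, c)` which the proof constructs is zero. -/
theorem exists_vector {A B B' : ℂ[X]} (h1 : A * conj B = -((1 - X ^ 2) * B' * conj A))
    (h2 : B * conj B = (1 - X ^ 2) ^ 2 * (B' * conj B')) :
    ∃ a b c : ℝ[X], c.map Complex.ofRealHom = -(A + conj A) ∧
      a.map Complex.ofRealHom + C Complex.I * b.map Complex.ofRealHom =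
        B - (1 - X ^ 2) * conj B' ∧
      ∃ r : ℂ[X], (A ^ 2 + B * B') • (!![(1 - X ^ 2) * c.map Complex.ofRealHom,
        -((1 - X ^ 2) * (a.map Complex.ofRealHom + C Complex.I * b.map Complex.ofRealHom));
        a.map Complex.ofRealHom - C Complex.I * b.map Complex.ofRealHom,
        -((1 - X ^ 2) * c.map Complex.ofRealHom)] : Matrix (Fin 2) (Fin 2) ℂ[X]) =
        r • !![A, B; B', -A] := by
  obtain ⟨c, hc⟩ := exists_real_of_conj_eq (p := -(A + conj A)) (by simp [add_comm])
  obtain ⟨a, b, hab⟩ := exists_re_im (B - (1 - X ^ 2) * conj B')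
  have hm := congrArg conj hab
  simp only [conj_sub, conj_mul, conj_conj, conj_add, conj_one, conj_pow, conj_X, conj_map_ofReal,
    conj_C, Complex.conj_I, C_neg] at hm
  have h1' := congrArg conj h1
  simp only [conj_sub, conj_mul, conj_conj, conj_neg, conj_one, conj_pow, conj_X] at h1'
  have hm' : a.map Complex.ofRealHom - C Complex.I * b.map Complex.ofRealHom =
      conj B - (1 - X ^ 2) * B' := by rw [hm]; ring
  refine ⟨a, b, c, hc.symm, hab.symm,
    A * ((1 - X ^ 2) * -(A + conj A)) + B * (conj B - (1 - X ^ 2) * B'), ?_⟩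
  rw [hm', ← hab, ← hc]
  refine Matrix.ext fun i j => ?_
  fin_cases i <;> fin_cases j <;> simp
  · linear_combination (-B) * h1
  · linear_combination (1 - X ^ 2) * A * h1' - B * h2
  · linear_combination A * h1
  · linear_combination (-B) * h1

/-- The form `x² + y² - (1 - t²) w²` is anisotropic over `ℝ(t)`, because it is definite for
`t > 1`. -/
theorem eq_zero_of_isotropic {a b c : ℝ[X]} (h : a ^ 2 + b ^ 2 - (1 - X ^ 2) * c ^ 2 = 0) :
    a = 0 ∧ b = 0 ∧ c = 0 := by
  have key : ∀ t ∈ Set.Ioi (1 : ℝ), a.eval t = 0 ∧ b.eval t = 0 ∧ c.eval t = 0 := by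
    intro t ht
    have h1 := congrArg (Polynomial.eval t) h
    simp only [eval_sub, eval_add, eval_mul, eval_pow, eval_one, eval_X, eval_zero] at h1
    have ht' : 0 < t ^ 2 - 1 := by nlinarith [Set.mem_Ioi.1 ht]
    have h2 := sq_nonneg (a.eval t)
    have h3 := sq_nonneg (b.eval t)
    have h4 := mul_nonneg ht'.le (sq_nonneg (c.eval t))
    refine ⟨pow_eq_zero_iff two_ne_zero |>.1 (by linarith),
      pow_eq_zero_iff two_ne_zero |>.1 (by linarith), ?_⟩
    have : (t ^ 2 - 1) * c.eval t ^ 2 = 0 := by linarith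
    exact pow_eq_zero_iff two_ne_zero |>.1 ((mul_eq_zero.1 this).resolve_left ht'.ne')
  have hinf := Set.Ioi_infinite (1 : ℝ)
  exact ⟨eq_zero_of_infinite_isRoot _ (hinf.mono fun t ht => (key t ht).1),
    eq_zero_of_infinite_isRoot _ (hinf.mono fun t ht => (key t ht).2.1),
    eq_zero_of_infinite_isRoot _ (hinf.mono fun t ht => (key t ht).2.2)⟩

/-- A nonzero vector of polynomials is a multiple of one without common zeros. -/
theorem exists_primitive {a b c : ℝ[X]} (h : ¬(a = 0 ∧ b = 0 ∧ c = 0)) :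
    ∃ g a' b' c' : ℝ[X], g ≠ 0 ∧ a = g * a' ∧ b = g * b' ∧ c = g * c' ∧
      ∀ t, ¬(a'.eval t = 0 ∧ b'.eval t = 0 ∧ c'.eval t = 0) := by
  obtain ⟨g, hg⟩ := (IsPrincipalIdealRing.principal (Ideal.span {a, b, c})).principal
  change Ideal.span {a, b, c} = Ideal.span {g} at hg
  have hmem : ∀ p ∈ ({a, b, c} : Set ℝ[X]), g ∣ p := fun p hp =>
    Ideal.mem_span_singleton.1 (hg ▸ Ideal.subset_span hp)
  obtain ⟨a', ha⟩ := hmem a (by simp)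
  obtain ⟨b', hb⟩ := hmem b (by simp)
  obtain ⟨c', hc⟩ := hmem c (by simp)
  have hg0 : g ≠ 0 := by
    rintro rfl
    exact h (by simp [ha, hb, hc])
  obtain ⟨u, v, w, huvw⟩ := Submodule.mem_span_triple.1
    (show g ∈ Ideal.span {a, b, c} from hg ▸ Ideal.subset_span rfl)
  simp only [smul_eq_mul] at huvw
  have h1 : u * a' + v * b' + w * c' = 1 := by
    refine mul_left_cancel₀ hg0 ?_
    rw [ha, hb, hc] at huvw
    linear_combination huvw
  refine ⟨g, a', b', c', hg0, ha, hb, hc, fun t ht => ?_⟩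
  have := congrArg (Polynomial.eval t) h1
  simp [ht.1, ht.2.1, ht.2.2] at this

/-- Every involution of `Bir(S/π)` is a reflection in a primitive vector. -/
theorem exists_refl_of_involution {f : Bir} (hf : f ∈ BirOver) (hff : f * f = 1) (hf1 : f ≠ 1) :
    ∃ d : ReflData, d.e = 1 ∧ (f : DomRat) = d.refl ∧
      ∀ t, ¬(d.a.eval t = 0 ∧ d.b.eval t = 0 ∧ d.c.eval t = 0) := by
  obtain ⟨M, hM⟩ := exists_mob f hf
  have htr := hM.trace_eq_zero (by rw [← Units.val_mul, hff, Units.val_one])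
    (fun h => hf1 (Units.ext h))
  obtain ⟨h1, h2⟩ := hM.real
  have hdet := hM.det_ne_zero
  rw [Matrix.det_fin_two, htr] at hdet
  rw [htr, conj_neg] at h1 h2
  have hMeq : M = !![M 0 0, M 0 1; M 1 0, -M 0 0] := by
    rw [← htr]
    exact Matrix.eta_fin_two M
  generalize M 0 0 = A at *
  generalize M 0 1 = B at *
  generalize M 1 0 = B' at *
  -- Both `M` and `i M` yield a vector, and one of these is nonzero.
  obtain ⟨a, b, c, δ, r, hδ, habc, hV⟩ : ∃ (a b c : ℝ[X]) (δ r : ℂ[X]), δ ≠ 0 ∧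
      ¬(a = 0 ∧ b = 0 ∧ c = 0) ∧
      δ • (!![(1 - X ^ 2) * c.map Complex.ofRealHom,
        -((1 - X ^ 2) * (a.map Complex.ofRealHom + C Complex.I * b.map Complex.ofRealHom));
        a.map Complex.ofRealHom - C Complex.I * b.map Complex.ofRealHom,
        -((1 - X ^ 2) * c.map Complex.ofRealHom)] : Matrix (Fin 2) (Fin 2) ℂ[X]) = r • M := by
    have hI : (C Complex.I : ℂ[X]) ^ 2 = -1 := by rw [← C_pow, Complex.I_sq]; simp
    have hδ : A ^ 2 + B * B' ≠ 0 := fun h => hdet (by linear_combination -h)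
    obtain ⟨a, b, c, hc, hab, r, hr⟩ := exists_vector (A := A) (B := B) (B' := B')
      (by linear_combination h1) (by linear_combination h2)
    by_cases h0 : a = 0 ∧ b = 0 ∧ c = 0
    · obtain ⟨a', b', c', hc', hab', r', hr'⟩ := exists_vector (A := C Complex.I * A)
        (B := C Complex.I * B) (B' := C Complex.I * B')
        (by
          simp only [conj_mul, conj_C, Complex.conj_I, C_neg]
          linear_combination (-C Complex.I ^ 2) * h1)
        (by
          simp only [conj_mul, conj_C, Complex.conj_I, C_neg]
          linear_combination (-C Complex.I ^ 2) * h2)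
      refine ⟨a', b', c', -(A ^ 2 + B * B'), r' * C Complex.I, neg_ne_zero.2 hδ, ?_, ?_⟩
      · rintro ⟨rfl, rfl, rfl⟩
        obtain ⟨rfl, rfl, rfl⟩ := h0
        simp only [Polynomial.map_zero, mul_zero, add_zero, conj_mul, conj_C, Complex.conj_I,
          C_neg] at hc hab hc' hab'
        have hA : (2 * C Complex.I) * A = 0 := by
          linear_combination C Complex.I * hc + hc'
        have hB : (2 * C Complex.I) * B = 0 := by
          linear_combination (-C Complex.I) * hab - hab'
        have hI0 : (2 * C Complex.I : ℂ[X]) ≠ 0 :=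
          mul_ne_zero two_ne_zero (C_ne_zero.2 Complex.I_ne_zero)
        refine hδ ?_
        rw [(mul_eq_zero.1 hA).resolve_left hI0, (mul_eq_zero.1 hB).resolve_left hI0]
        ring
      · rw [hMeq, mul_smul]
        convert hr' using 1
        · congr 1
          linear_combination (-(A ^ 2 + B * B')) * hI
        · congr 1
          ext i j : 1
          fin_cases i <;> fin_cases j <;> simp
    · exact ⟨a, b, c, _, r, hδ, h0, hMeq ▸ hr⟩
  obtain ⟨g, a', b', c', hg, rfl, rfl, rfl, hprim⟩ := exists_primitive habc
  let d : ReflData :=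
    { e := 1
      e' := 1 - X ^ 2
      a := a'
      b := b'
      c := c'
      mul_eq := by ring
      ne_zero := fun h => by
        rw [one_mul] at h
        obtain ⟨rfl, rfl, rfl⟩ := eq_zero_of_isotropic h
        exact hprim 0 (by simp) }
  have hVd : (δ * g.map Complex.ofRealHom) • d.mob = r • M := by
    rw [← hV, mul_smul]
    congr 1
    ext i j : 1
    fin_cases i <;> fin_cases j <;> simp [ReflData.mob, ReflData.m, ReflData.mbar, d] <;> ring
  have hr : r ≠ 0 := by
    rintro rfl
    rw [zero_smul] at hVd
    have h3 := congrArg Matrix.det hVd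
    rw [Matrix.det_smul, Matrix.det_zero] at h3
    exact mul_ne_zero (pow_ne_zero _ (mul_ne_zero hδ (ReflData.map_ofReal_ne_zero hg)))
      d.det_mob_ne_zero h3
  exact ⟨d, rfl, hM.ext d.mob_refl hr hVd, hprim⟩

/-- A reflection which is defined at all real points together with its inverse does not contract
a circle to a point: `Q` does not vanish at `t ∈ (-1, 1)`. -/
theorem Q_eval_ne_zero {f : Bir} (hf : f ∈ AutReal) {d : ReflData} (hd : d.e = 1)
    (hfd : (f : DomRat) = d.refl)
    (hprim : ∀ t, ¬(d.a.eval t = 0 ∧ d.b.eval t = 0 ∧ d.c.eval t = 0)) {t : ℝ} (ht : -1 < t)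
    (ht' : t < 1) : d.Q.eval t ≠ 0 := by
  intro hQ
  have hee := d.eval_mul_eq t
  have hq := d.eval_Q t
  rw [hQ, hd, eval_one, one_mul] at hq
  rw [hd, eval_one, one_mul] at hee
  have hs : 0 < 1 - t ^ 2 := by nlinarith
  have hab : d.a.eval t ^ 2 + d.b.eval t ^ 2 = (1 - t ^ 2) * d.c.eval t ^ 2 := by
    rw [← hee]; linarith
  have hc : d.c.eval t ≠ 0 := by
    intro hc
    rw [hc] at hab
    refine hprim t ⟨pow_eq_zero_iff two_ne_zero |>.1 ?_, pow_eq_zero_iff two_ne_zero |>.1 ?_, hc⟩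
    · nlinarith [sq_nonneg (d.a.eval t), sq_nonneg (d.b.eval t)]
    · nlinarith [sq_nonneg (d.a.eval t), sq_nonneg (d.b.eval t)]
  have hu : OnSphere (d.a.eval t / d.c.eval t) (d.b.eval t / d.c.eval t) t := by
    refine ⟨?_, ht, ht'⟩
    field_simp
    linarith
  -- Every point `p` of the circle with `Λ(p) ≠ 0` is mapped to the same point `(a/c, b/c, t)`.
  have hval : ∀ x y i, MvPolynomial.eval (pt x y t) (d.coords i) =
      (-2 * d.lam x y t * d.c.eval t) *
        pt (d.a.eval t / d.c.eval t) (d.b.eval t / d.c.eval t) t i := by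
    intro x y i
    have h0 : MvPolynomial.eval (pt x y t) (d.coords 0) = -2 * d.lam x y t * d.c.eval t := by
      rw [d.eval_coords_zero, hQ]; ring
    fin_cases i
    · simpa using h0
    · simp [d.eval_coords_one, hQ, hd]; field_simp
    · simp [d.eval_coords_two, hQ, hd]; field_simp
    · simp only [Fin.reduceFinMk, d.eval_coords_three, h0, pt_three]; ring
  obtain ⟨H, hH, j, hj⟩ := (hf _ hu.isRealPoint).2
  have hcomp : DomRat.mk (H.comp d.rep) = DomRat.mk Rep.id := by
    rw [← DomRat.mk_mul_mk, hH, ← DomRat.one_def, show DomRat.mk d.rep = f from hfd.symm]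
    exact f.inv_mul
  have hcross : ∀ x y, OnSphere x y t → d.lam x y t ≠ 0 → ∀ i k,
      MvPolynomial.eval (pt (d.a.eval t / d.c.eval t) (d.b.eval t / d.c.eval t) t) (H.F i) *
        pt x y t k =
      MvPolynomial.eval (pt (d.a.eval t / d.c.eval t) (d.b.eval t / d.c.eval t) t) (H.F k) *
        pt x y t i := by
    intro x y hon hl i k
    have h1 := cross_eq hcomp rfl hon.eval_quadric i k
    simp only [Rep.eval_comp] at h1
    have h2 : (fun j => MvPolynomial.eval (pt x y t) (d.rep.F j)) = fun j =>
        (-2 * d.lam x y t * d.c.eval t) *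
          pt (d.a.eval t / d.c.eval t) (d.b.eval t / d.c.eval t) t j := funext fun j => hval x y j
    simp only [h2, eval_mul_of_isHomogeneous (H.homogeneous _), Rep.id, MvPolynomial.eval_X] at h1
    have h3 : -2 * d.lam x y t * d.c.eval t ≠ 0 :=
      mul_ne_zero (mul_ne_zero (by norm_num) hl) hc
    refine mul_left_cancel₀ (pow_ne_zero H.deg h3) ?_
    linear_combination h1
  have hx1 : OnSphere (-(d.a.eval t / d.c.eval t)) (-(d.b.eval t / d.c.eval t)) t :=
    ⟨by rw [neg_sq, neg_sq]; exact hu.1, hu.2⟩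
  have hx2 : OnSphere (-(d.b.eval t / d.c.eval t)) (d.a.eval t / d.c.eval t) t :=
    ⟨by rw [neg_sq, add_comm]; exact hu.1, hu.2⟩
  have hl1 : d.lam (-(d.a.eval t / d.c.eval t)) (-(d.b.eval t / d.c.eval t)) t ≠ 0 := by
    have : d.lam (-(d.a.eval t / d.c.eval t)) (-(d.b.eval t / d.c.eval t)) t =
        -2 * (1 - t ^ 2) * d.c.eval t := by
      simp only [ReflData.lam, hee]
      field_simp
      linear_combination -hab
    rw [this]
    exact mul_ne_zero (mul_ne_zero (by norm_num) hs.ne') hc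
  have hl2 : d.lam (-(d.b.eval t / d.c.eval t)) (d.a.eval t / d.c.eval t) t ≠ 0 := by
    have : d.lam (-(d.b.eval t / d.c.eval t)) (d.a.eval t / d.c.eval t) t =
        -(1 - t ^ 2) * d.c.eval t := by
      simp only [ReflData.lam, hee]
      field_simp
      ring
    rw [this]
    exact mul_ne_zero (neg_ne_zero.2 hs.ne') hc
  set h0 := MvPolynomial.eval (pt (d.a.eval t / d.c.eval t) (d.b.eval t / d.c.eval t) t) (H.F 0)
    with hh0
  have hh : h0 ≠ 0 := by
    intro hz
    have := hcross _ _ hx1 hl1 j 0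
    rw [← hh0, hz, pt_zero, zero_mul, mul_one] at this
    exact hj this
  have c1 := hcross _ _ hx1 hl1 0 1
  have c2 := hcross _ _ hx2 hl2 0 1
  have c3 := hcross _ _ hx1 hl1 0 2
  have c4 := hcross _ _ hx2 hl2 0 2
  simp only [pt_zero, pt_one, pt_two, ← hh0, mul_one] at c1 c2 c3 c4
  have e1 := mul_left_cancel₀ hh (c1.trans c2.symm)
  have e2 := mul_left_cancel₀ hh (c3.trans c4.symm)
  have ha : d.a.eval t / d.c.eval t = 0 := by linarith
  have hb : d.b.eval t / d.c.eval t = 0 := by linarith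
  have := hu.1
  rw [ha, hb] at this
  linarith

/-- If `a` and `b` vanish at a pole but `c` does not, then the form takes negative values. -/
theorem exists_form_neg {a b c : ℝ[X]} {ε : ℝ} (hε : ε = 1 ∨ ε = -1) (ha : a.eval ε = 0)
    (hb : b.eval ε = 0) (hc : c.eval ε ≠ 0) :
    ∃ t, -1 < t ∧ t < 1 ∧ a.eval t ^ 2 + b.eval t ^ 2 - (1 - t ^ 2) * c.eval t ^ 2 < 0 := by
  obtain ⟨a, rfl⟩ := dvd_iff_isRoot.2 ha
  obtain ⟨b, rfl⟩ := dvd_iff_isRoot.2 hb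
  have hε2 : ε ^ 2 = 1 := by rcases hε with rfl | rfl <;> norm_num
  let h : ℝ → ℝ := fun t => (1 - ε * t) * (a.eval t ^ 2 + b.eval t ^ 2) - (1 + ε * t) * c.eval t ^ 2
  have hcont : Continuous h := by
    have h1 := a.continuous
    have h2 := b.continuous
    have h3 := c.continuous
    fun_prop
  have hneg : h ε < 0 := by
    have : 0 < c.eval ε ^ 2 := by positivity
    simp only [h]
    rw [← sq, hε2]
    linarith
  obtain ⟨δ, hδ, hball⟩ := Metric.isOpen_iff.1 (isOpen_lt hcont continuous_const) ε hneg
  have hη : 0 < min (δ / 2) (1 / 2) := by positivity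
  have hη1 := min_le_left (δ / 2) (1 / 2)
  have hη2 := min_le_right (δ / 2) (1 / 2)
  set η := min (δ / 2) (1 / 2)
  have hlt : h (ε * (1 - η)) < 0 := by
    refine hball ?_
    rw [Metric.mem_ball, Real.dist_eq, show ε * (1 - η) - ε = -(ε * η) by ring, abs_neg, abs_mul,
      abs_of_pos hη]
    rcases hε with rfl | rfl <;> simp <;> linarith
  refine ⟨ε * (1 - η), ?_, ?_, ?_⟩
  · rcases hε with rfl | rfl <;> linarith
  · rcases hε with rfl | rfl <;> linarith
  · set t := ε * (1 - η) with ht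
    have h1 : 0 < 1 - ε * t := by
      have : 1 - ε * t = η := by rw [ht]; linear_combination (η - 1) * hε2
      rwa [this]
    have : (eval t ((X - C ε) * a)) ^ 2 + (eval t ((X - C ε) * b)) ^ 2 -
        (1 - t ^ 2) * eval t c ^ 2 = (1 - ε * t) * h t := by
      simp only [eval_mul, eval_sub, eval_X, eval_C, h]
      linear_combination ((1 - t ^ 2) * (a.eval t ^ 2 + b.eval t ^ 2) - t ^ 2 * c.eval t ^ 2) * hε2
    rw [this]
    exact mul_neg_of_pos_of_neg h1 hlt

theorem one_sub_X_sq_dvd {a : ℝ[X]} (h1 : a.eval 1 = 0) (h2 : a.eval (-1) = 0) :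
    1 - X ^ 2 ∣ a := by
  obtain ⟨q, rfl⟩ := dvd_iff_isRoot.2 h1
  have h3 : q.eval (-1) = 0 := by
    rw [eval_mul] at h2
    refine (mul_eq_zero.1 h2).resolve_left ?_
    simp
    norm_num
  obtain ⟨r, rfl⟩ := dvd_iff_isRoot.2 h3
  exact ⟨-r, by simp only [C_neg, C_1]; ring⟩

/-- The involutions in `Aut(S(ℝ)/π)` are the reflections in vectors which are nowhere isotropic
on `[-1, 1]`, once zeros of the form at the poles are removed. The spacelike ones have two fixed
points on each circle, the timelike ones have none. -/
theorem exists_refl_of_mem_autRealOver {f : Bir} (hf : f ∈ AutRealOver) (hff : f * f = 1)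
    (hf1 : f ≠ 1) :
    (∃ d : ReflData, d.e = 1 ∧ d.e' = 1 - X ^ 2 ∧ f = d.unit ∧
      ∀ t ∈ Set.Icc (-1 : ℝ) 1, 0 < d.Q.eval t) ∨
    ∃ d : ReflData, d.e = 1 - X ^ 2 ∧ d.e' = 1 ∧ f = d.unit ∧
      ∀ t ∈ Set.Icc (-1 : ℝ) 1, d.Q.eval t < 0 := by
  obtain ⟨d, he, hfd, hprim⟩ := exists_refl_of_involution hf.2 hff hf1
  have he' : d.e' = 1 - X ^ 2 := by rw [← d.mul_eq, he, one_mul]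
  have hne : ∀ t ∈ Set.Ioo (-1 : ℝ) 1, d.Q.eval t ≠ 0 := fun t ht =>
    Q_eval_ne_zero hf.1 he hfd hprim ht.1 ht.2
  have hQ : ∀ t, d.Q.eval t =
      d.a.eval t ^ 2 + d.b.eval t ^ 2 - (1 - t ^ 2) * d.c.eval t ^ 2 := fun t => by
    rw [d.eval_Q, he, he']; simp
  have hcont : Continuous fun t => d.Q.eval t := d.Q.continuous
  have hsign : (∀ t ∈ Set.Ioo (-1 : ℝ) 1, 0 < d.Q.eval t) ∨
      ∀ t ∈ Set.Ioo (-1 : ℝ) 1, d.Q.eval t < 0 := by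
    by_contra! hcon
    obtain ⟨⟨t, ht, htQ⟩, u, hu, huQ⟩ := hcon
    obtain ⟨r, hr, hr0⟩ := isPreconnected_Ioo.intermediate_value ht hu hcont.continuousOn ⟨htQ, huQ⟩
    exact hne r hr hr0
  have hend : ∀ t ∈ Set.Icc (-1 : ℝ) 1, t ∈ Set.Ioo (-1 : ℝ) 1 ∨ t = 1 ∨ t = -1 := by
    intro t ht
    rcases eq_or_lt_of_le ht.1 with h | h
    · exact Or.inr (Or.inr h.symm)
    · rcases eq_or_lt_of_le ht.2 with h' | h'
      · exact Or.inr (Or.inl h')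
      · exact Or.inl ⟨h, h'⟩
  rcases hsign with hpos | hneg
  · refine Or.inl ⟨d, he, he', Units.ext hfd, fun t ht => ?_⟩
    rcases hend t ht with h | hε
    · exact hpos t h
    · have ht2 : t ^ 2 = 1 := by rcases hε with rfl | rfl <;> norm_num
      rw [hQ, ht2, sub_self, zero_mul, sub_zero]
      by_contra hle
      have ha := sq_nonneg (d.a.eval t)
      have hb := sq_nonneg (d.b.eval t)
      have ha0 : d.a.eval t = 0 := pow_eq_zero_iff two_ne_zero |>.1 (by linarith)
      have hb0 : d.b.eval t = 0 := pow_eq_zero_iff two_ne_zero |>.1 (by linarith)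
      obtain ⟨u, hu, hu', hlt⟩ := exists_form_neg hε ha0 hb0 fun hc => hprim t ⟨ha0, hb0, hc⟩
      have := hpos u ⟨hu, hu'⟩
      rw [hQ] at this
      linarith
  · have hpole : ∀ ε : ℝ, ε = 1 ∨ ε = -1 →
        d.a.eval ε = 0 ∧ d.b.eval ε = 0 ∧ d.c.eval ε ≠ 0 := by
      intro ε hε
      have hle : d.Q.eval ε ≤ 0 := by
        have hcl : IsClosed {t : ℝ | d.Q.eval t ≤ 0} := isClosed_le hcont continuous_const
        have hsub : Set.Icc (-1 : ℝ) 1 ⊆ {t : ℝ | d.Q.eval t ≤ 0} := by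
          rw [← closure_Ioo (by norm_num)]
          exact hcl.closure_subset_iff.2 fun t ht => (hneg t ht).le
        refine hsub ?_
        rcases hε with rfl | rfl <;> simp
      have ht2 : ε ^ 2 = 1 := by rcases hε with rfl | rfl <;> norm_num
      rw [hQ, ht2, sub_self, zero_mul, sub_zero] at hle
      have ha := sq_nonneg (d.a.eval ε)
      have hb := sq_nonneg (d.b.eval ε)
      have ha0 : d.a.eval ε = 0 := pow_eq_zero_iff two_ne_zero |>.1 (by linarith)
      have hb0 : d.b.eval ε = 0 := pow_eq_zero_iff two_ne_zero |>.1 (by linarith)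
      exact ⟨ha0, hb0, fun hc => hprim ε ⟨ha0, hb0, hc⟩⟩
    obtain ⟨a, ha⟩ := one_sub_X_sq_dvd (hpole 1 (Or.inl rfl)).1 (hpole (-1) (Or.inr rfl)).1
    obtain ⟨b, hb⟩ := one_sub_X_sq_dvd (hpole 1 (Or.inl rfl)).2.1 (hpole (-1) (Or.inr rfl)).2.1
    have hQQ : d.Q = (1 - X ^ 2) * ((1 - X ^ 2) * (a ^ 2 + b ^ 2) - 1 * d.c ^ 2) := by
      rw [ReflData.Q, he, he', ha, hb]; ring
    let d' : ReflData :=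
      { e := 1 - X ^ 2
        e' := 1
        a := a
        b := b
        c := d.c
        mul_eq := by ring
        ne_zero := fun h => d.ne_zero (by
          change d.Q = 0
          rw [hQQ, h, mul_zero]) }
    have hQ' : ∀ t, d.Q.eval t = (1 - t ^ 2) * d'.Q.eval t := fun t => by
      rw [hQQ]
      simp [ReflData.Q, d']
    refine Or.inr ⟨d', rfl, rfl, Units.ext (hfd.trans ?_), fun t ht => ?_⟩
    · refine d.mob_refl.ext d'.mob_refl (c := 1) (d := 1 - X ^ 2) one_ne_zero ?_
      rw [one_smul]
      refine Matrix.ext fun i j => ?_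
      fin_cases i <;> fin_cases j <;>
        simp [ReflData.mob, ReflData.m, ReflData.mbar, d', he', ha, hb] <;>
        first | ring1 | (left; ring1)
    · rcases hend t ht with h | hε
      · have h1 := hneg t h
        rw [hQ'] at h1
        have h2 : 0 < 1 - t ^ 2 := by nlinarith [h.1, h.2]
        exact (pos_iff_neg_of_mul_neg h1).1 h2
      · have ht2 : t ^ 2 = 1 := by rcases hε with rfl | rfl <;> norm_num
        have := (hpole t hε).2.2
        have : 0 < d.c.eval t ^ 2 := by positivity
        rw [d'.eval_Q]
        simp [d', ht2]
        assumption

/-! ### The invariant of a conjugacy class -/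

/-- A real polynomial which is a square over `ℂ` is a square over `ℝ` up to sign. -/
theorem eq_sq_or_eq_neg_sq {D : ℝ[X]} {R : ℂ[X]} (h : D.map Complex.ofRealHom = R ^ 2) :
    ∃ r : ℝ[X], D = r ^ 2 ∨ D = -r ^ 2 := by
  have hI : (C Complex.I : ℂ[X]) ^ 2 = -1 := by rw [← C_pow, Complex.I_sq]; simp
  have h1 := congrArg conj h
  rw [conj_map_ofReal, h, conj_pow] at h1
  have hinj := map_injective Complex.ofRealHom Complex.ofRealHom.injective
  rcases sq_eq_sq_iff_eq_or_eq_neg.1 h1 with h2 | h2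
  · obtain ⟨r, rfl⟩ := exists_real_of_conj_eq h2.symm
    exact ⟨r, Or.inl (hinj (by rw [h, Polynomial.map_pow]))⟩
  · obtain ⟨r, hr⟩ := exists_real_of_conj_eq (p := C Complex.I * R) (by
      rw [conj_mul, conj_C, Complex.conj_I, C_neg]
      linear_combination (-C Complex.I) * h2)
    refine ⟨r, Or.inr (hinj ?_)⟩
    rw [h, Polynomial.map_neg, Polynomial.map_pow, ← hr]
    linear_combination R ^ 2 * hI

/-- The determinants of conjugate reflections differ by a square factor, up to sign. -/
theorem exists_det_mul_det_eq {d d' : ReflData} {h : Bir} (hh : h ∈ BirOver)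
    (hc : h * d.unit = d'.unit * h) :
    ∃ r : ℝ[X], (d.e' * d.Q) * (d'.e' * d'.Q) = r ^ 2 ∨
      (d.e' * d.Q) * (d'.e' * d'.Q) = -r ^ 2 := by
  obtain ⟨H, hH⟩ := exists_mob h hh
  have h1 := hH.mul d.mob_refl
  have h2 : Mob ((h : DomRat) * d.refl) (d'.mob * H) := by
    have : (h : DomRat) * d.refl = d'.refl * h := congrArg Units.val hc
    rw [this]
    exact d'.mob_refl.mul hH
  obtain ⟨c, hc0, hc⟩ := h1.unique h2
  have hdet := congrArg Matrix.det hc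
  simp only [Matrix.det_smul, Matrix.det_mul, Fintype.card_fin] at hdet
  have hH0 := hH.det_ne_zero
  have hδ : H.det * d.mob.det ≠ 0 := mul_ne_zero hH0 d.det_mob_ne_zero
  set δ := H.det * d.mob.det
  have h3 : δ ^ 2 * d'.mob.det = c ^ 2 * d.mob.det := by
    refine mul_left_cancel₀ hH0 ?_
    linear_combination hdet
  obtain ⟨R, hR⟩ : δ ∣ c * d.mob.det := by
    rw [← IsIntegrallyClosed.pow_dvd_pow_iff two_ne_zero]
    exact ⟨d.mob.det * d'.mob.det, by linear_combination (-d.mob.det) * h3⟩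
  refine eq_sq_or_eq_neg_sq (R := R) ?_
  rw [Polynomial.map_mul, ← d.det_mob, ← d'.det_mob]
  refine mul_left_cancel₀ (pow_ne_zero 2 hδ) ?_
  linear_combination d.mob.det * h3 + (c * d.mob.det + δ * R) * hR

/-- The square-class invariant distinguishes vectors which are isotropic at the poles from vectors
which are not: the difference is the parity of the order of vanishing at `t = 1`. -/
theorem not_isSquare_of_eval_ne_zero {q r : ℝ[X]} (hq : q.eval 1 ≠ 0) :
    ¬((1 - X ^ 2) * q = r ^ 2 ∨ (1 - X ^ 2) * q = -r ^ 2) := by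
  intro h
  have h1 : r.eval 1 = 0 := by
    refine pow_eq_zero_iff two_ne_zero |>.1 ?_
    rcases h with h | h <;>
    · have := congrArg (Polynomial.eval 1) h
      simp only [eval_mul, eval_sub, eval_one, eval_pow, eval_X, eval_neg] at this
      linarith
  obtain ⟨k, rfl⟩ := dvd_iff_isRoot.2 h1
  have hX : (X - C 1 : ℝ[X]) ≠ 0 := X_sub_C_ne_zero 1
  have h2 : (1 + X) * q = -((X - C 1) * k ^ 2) ∨ (1 + X) * q = (X - C 1) * k ^ 2 := by
    rw [C_1] at h hX ⊢
    refine h.imp (fun h => mul_left_cancel₀ hX ?_) (fun h => mul_left_cancel₀ hX ?_) <;>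
    linear_combination -h
  rcases h2 with h2 | h2 <;>
  · have := congrArg (Polynomial.eval 1) h2
    simp at this
    exact hq this

/-- The values of `Q` at conjugate reflections of the same type differ by a square factor. -/
theorem exists_Q_mul_Q_eq {d d' : ReflData} {h : Bir} (hh : h ∈ BirOver)
    (hc : h * d.unit = d'.unit * h) (he : d.e' = d'.e') (hpos : 0 < d.Q.eval 0 * d'.Q.eval 0) :
    ∃ r : ℝ[X], d.Q * d'.Q = r ^ 2 := by
  have main : ∀ D r : ℝ[X], d.e' ^ 2 * D = r ^ 2 → ∃ r, D = r ^ 2 := by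
    intro D r hr
    obtain ⟨k, rfl⟩ : d.e' ∣ r := by
      rw [← IsIntegrallyClosed.pow_dvd_pow_iff two_ne_zero]
      exact ⟨D, hr.symm⟩
    refine ⟨k, mul_left_cancel₀ (pow_ne_zero 2 d.e'_ne_zero) ?_⟩
    rw [hr]; ring
  obtain ⟨r, hr | hr⟩ := exists_det_mul_det_eq hh hc
  · exact main _ r (by rw [← hr, ← he]; ring)
  · obtain ⟨k, hk⟩ := main (-(d.Q * d'.Q)) r (by rw [← neg_eq_iff_eq_neg.2 hr, ← he]; ring)
    have := congrArg (Polynomial.eval 0) hk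
    simp only [eval_neg, eval_mul, eval_pow] at this
    nlinarith [sq_nonneg (k.eval 0)]

/-! ### Conjugating reflections -/

namespace ReflData

variable (d : ReflData)

/-- A multiple of a vector. -/
def scale (g : ℝ[X]) (hg : g ≠ 0) : ReflData where
  e := d.e
  e' := d.e'
  a := g * d.a
  b := g * d.b
  c := g * d.c
  mul_eq := d.mul_eq
  ne_zero := by
    have : d.e * ((g * d.a) ^ 2 + (g * d.b) ^ 2) - d.e' * (g * d.c) ^ 2 = g ^ 2 * d.Q := by
      rw [Q]; ring
    rw [this]
    exact mul_ne_zero (pow_ne_zero 2 hg) d.ne_zero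

theorem scale_Q (g : ℝ[X]) (hg : g ≠ 0) : (d.scale g hg).Q = g ^ 2 * d.Q := by
  simp only [Q, scale]; ring

theorem unit_scale (g : ℝ[X]) (hg : g ≠ 0) : (d.scale g hg).unit = d.unit := by
  refine Units.ext ((d.scale g hg).mob_refl.ext d.mob_refl (c := 1)
    (d := g.map Complex.ofRealHom) one_ne_zero ?_)
  rw [one_smul]
  refine Matrix.ext fun i j => ?_
  fin_cases i <;> fin_cases j <;> simp [mob, m, mbar, scale] <;> ring

theorem mob_mul_mob : d.mob * d.mob = -((d.e' * d.Q).map Complex.ofRealHom) • 1 := by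
  rw [← det_mob, mob, Matrix.det_fin_two_of, Matrix.mul_fin_two]
  refine Matrix.ext fun i j => ?_
  fin_cases i <;> fin_cases j <;> simp <;> ring

/-- The sum of two vectors. -/
def add (d' : ReflData) (h : d.e * ((d.a + d'.a) ^ 2 + (d.b + d'.b) ^ 2) -
    d.e' * (d.c + d'.c) ^ 2 ≠ 0) : ReflData where
  e := d.e
  e' := d.e'
  a := d.a + d'.a
  b := d.b + d'.b
  c := d.c + d'.c
  mul_eq := d.mul_eq
  ne_zero := h

/-- If `Q(v) = Q(v')`, then the reflection in `v + v'` conjugates the reflections in `v`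
and `v'`. -/
theorem unit_add_mul {d' : ReflData} (he' : d'.e' = d.e') (hQ : d.Q = d'.Q)
    (h : d.e * ((d.a + d'.a) ^ 2 + (d.b + d'.b) ^ 2) - d.e' * (d.c + d'.c) ^ 2 ≠ 0) :
    (d.add d' h).unit * d.unit = d'.unit * (d.add d' h).unit := by
  refine Units.ext (((d.add d' h).mob_refl.mul d.mob_refl).ext
    (d'.mob_refl.mul (d.add d' h).mob_refl) (c := 1) (d := 1) one_ne_zero ?_)
  have hadd : (d.add d' h).mob = d.mob + d'.mob := by
    refine Matrix.ext fun i j => ?_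
    fin_cases i <;> fin_cases j <;> simp [mob, m, mbar, add, he'] <;> ring
  rw [hadd, one_smul, one_smul, add_mul, mul_add, mob_mul_mob, mob_mul_mob, he', hQ, add_comm]

/-- The horizontal vector `(y₁, y₂, 0)`. -/
def horizontal (y₁ y₂ : ℝ[X]) (h : y₁ ^ 2 + y₂ ^ 2 ≠ 0) : ReflData where
  e := 1
  e' := 1 - X ^ 2
  a := y₁
  b := y₂
  c := 0
  mul_eq := by ring
  ne_zero := by simpa using h

theorem horizontal_Q (y₁ y₂ : ℝ[X]) (h : y₁ ^ 2 + y₂ ^ 2 ≠ 0) :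
    (horizontal y₁ y₂ h).Q = y₁ ^ 2 + y₂ ^ 2 := by
  simp [Q, horizontal]

/-- The image of a vector under the reflection in `(y₁, y₂, 0)`, up to scalar: with `y = y₁ + i y₂`
the vector `(m, c)` becomes `(y² m̄, -|y|² c)`. -/
def mirror (y₁ y₂ : ℝ[X]) (h : y₁ ^ 2 + y₂ ^ 2 ≠ 0) : ReflData where
  e := d.e
  e' := d.e'
  a := (y₁ ^ 2 - y₂ ^ 2) * d.a + 2 * y₁ * y₂ * d.b
  b := 2 * y₁ * y₂ * d.a - (y₁ ^ 2 - y₂ ^ 2) * d.b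
  c := -((y₁ ^ 2 + y₂ ^ 2) * d.c)
  mul_eq := d.mul_eq
  ne_zero := by
    have : d.e * (((y₁ ^ 2 - y₂ ^ 2) * d.a + 2 * y₁ * y₂ * d.b) ^ 2 +
        (2 * y₁ * y₂ * d.a - (y₁ ^ 2 - y₂ ^ 2) * d.b) ^ 2) -
        d.e' * (-((y₁ ^ 2 + y₂ ^ 2) * d.c)) ^ 2 = (y₁ ^ 2 + y₂ ^ 2) ^ 2 * d.Q := by
      rw [Q]; ring
    rw [this]
    exact mul_ne_zero (pow_ne_zero 2 h) d.ne_zero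

theorem mirror_Q (y₁ y₂ : ℝ[X]) (h : y₁ ^ 2 + y₂ ^ 2 ≠ 0) :
    (d.mirror y₁ y₂ h).Q = (y₁ ^ 2 + y₂ ^ 2) ^ 2 * d.Q := by
  simp only [Q, mirror]; ring

theorem horizontal_mul (y₁ y₂ : ℝ[X]) (h : y₁ ^ 2 + y₂ ^ 2 ≠ 0) (he' : d.e' = 1 - X ^ 2) :
    (horizontal y₁ y₂ h).unit * d.unit = (d.mirror y₁ y₂ h).unit * (horizontal y₁ y₂ h).unit := by
  refine Units.ext (((horizontal y₁ y₂ h).mob_refl.mul d.mob_refl).ext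
    ((d.mirror y₁ y₂ h).mob_refl.mul (horizontal y₁ y₂ h).mob_refl)
    (c := (y₁ ^ 2 + y₂ ^ 2).map Complex.ofRealHom) (d := 1) (map_ofReal_ne_zero h) ?_)
  have hI : (C Complex.I : ℂ[X]) ^ 2 = -1 := by rw [← C_pow, Complex.I_sq]; simp
  rw [one_smul]
  simp only [mob, m, mbar, mirror, horizontal, he', Matrix.mul_fin_two]
  refine Matrix.ext fun i j => ?_
  simp only [Polynomial.map_mul, Polynomial.map_add, Polynomial.map_sub, Polynomial.map_pow,
    Polynomial.map_one, Polynomial.map_X, Polynomial.map_neg, Polynomial.map_zero,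
    Polynomial.map_ofNat]
  generalize y₁.map Complex.ofRealHom = y
  generalize y₂.map Complex.ofRealHom = z
  generalize d.a.map Complex.ofRealHom = a
  generalize d.b.map Complex.ofRealHom = b
  generalize d.c.map Complex.ofRealHom = c
  generalize (C Complex.I : ℂ[X]) = I at *
  fin_cases i <;> fin_cases j <;> simp only [Fin.zero_eta, Matrix.of_apply,
    Matrix.cons_val', Matrix.cons_val_zero, Matrix.cons_val_fin_one, Matrix.smul_apply, smul_eq_mul,
    Fin.mk_one, Matrix.cons_val_one]
  · linear_combination (-(1 - X ^ 2) * ((-z ^ 2 * a + 2 * y * z * b + I * z ^ 2 * b) * (y - I * z) -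
      z ^ 2 * (y + I * z) * (a - I * b))) * hI
  · ring
  · ring
  · linear_combination (-(1 - X ^ 2) * ((-z ^ 2 * a + 2 * y * z * b - I * z ^ 2 * b) * (y + I * z) -
      z ^ 2 * (y - I * z) * (a + I * b))) * hI

end ReflData

/-! ### A continuous square root, and its approximation by polynomials -/

theorem exists_continuous_sqrt_sub {z : ℂ} (hz : ∀ t ∈ Set.Icc (-1 : ℝ) 1, (t : ℂ) ≠ z) :
    ∃ Y : ℝ → ℂ, ContinuousOn Y (Set.Icc (-1) 1) ∧
      ∀ t ∈ Set.Icc (-1 : ℝ) 1, Y t ^ 2 = (t : ℂ) - z := by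
  -- After multiplication by `±1` the segment lies in the slit plane.
  obtain ⟨ω, hω, hslit⟩ : ∃ ω : ℂ, ω ≠ 0 ∧
      ∀ t ∈ Set.Icc (-1 : ℝ) 1, ω * ((t : ℂ) - z) ∈ Complex.slitPlane := by
    by_cases him : z.im = 0
    · have hz' : ∀ t ∈ Set.Icc (-1 : ℝ) 1, t ≠ z.re := fun t ht h =>
        hz t ht (Complex.ext (by simpa using h) (by simpa using him.symm))
      by_cases hre : z.re < 1
      · refine ⟨1, one_ne_zero, fun t ht => Or.inl ?_⟩
        have : z.re < -1 := by
          by_contra hcon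
          exact hz' z.re ⟨not_lt.1 hcon, hre.le⟩ rfl
        simp
        linarith [ht.1]
      · refine ⟨-1, neg_ne_zero.2 one_ne_zero, fun t ht => Or.inl ?_⟩
        have h1 := lt_of_le_of_ne (not_lt.1 hre) (hz' 1 (by norm_num))
        simp
        linarith [ht.2]
    · refine ⟨1, one_ne_zero, fun t _ => Or.inr ?_⟩
      simpa using him
  obtain ⟨ρ, hρ⟩ := IsAlgClosed.exists_pow_nat_eq ω⁻¹ two_pos
  refine ⟨fun t => ρ * (ω * ((t : ℂ) - z)) ^ (1 / 2 : ℂ), ?_, fun t ht => ?_⟩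
  · refine continuousOn_const.mul (ContinuousOn.cpow_const ?_ fun t ht => hslit t ht)
    fun_prop
  · rw [mul_pow, hρ, ← Complex.cpow_nat_mul]
    field_simp
    simp

theorem exists_continuous_sqrt (P : ℂ[X]) (hP : ∀ t ∈ Set.Icc (-1 : ℝ) 1, P.eval (t : ℂ) ≠ 0) :
    ∃ Y : ℝ → ℂ, ContinuousOn Y (Set.Icc (-1) 1) ∧
      ∀ t ∈ Set.Icc (-1 : ℝ) 1, Y t ^ 2 = P.eval (t : ℂ) := by
  induction hn : P.natDegree generalizing P with
  | zero =>
    rw [eq_C_of_natDegree_eq_zero hn]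
    obtain ⟨ρ, hρ⟩ := IsAlgClosed.exists_pow_nat_eq (P.coeff 0) two_pos
    exact ⟨fun _ => ρ, continuousOn_const, fun t _ => by simp [hρ]⟩
  | succ n ih =>
    obtain ⟨z, hz⟩ := IsAlgClosed.exists_root P (by
      intro h
      have := natDegree_eq_zero_iff_degree_le_zero.2 h.le
      omega)
    obtain ⟨R, rfl⟩ := dvd_iff_isRoot.2 hz
    have hR0 : R ≠ 0 := by rintro rfl; simp at hn
    simp only [eval_mul, eval_sub, eval_X, eval_C] at hP ⊢
    obtain ⟨Y, hY, hY'⟩ := ih R (fun t ht => right_ne_zero_of_mul (hP t ht)) (by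
      rw [natDegree_mul (X_sub_C_ne_zero z) hR0, natDegree_X_sub_C] at hn
      omega)
    obtain ⟨W, hW, hW'⟩ := exists_continuous_sqrt_sub (z := z) fun t ht =>
      sub_ne_zero.1 (left_ne_zero_of_mul (hP t ht))
    exact ⟨fun t => W t * Y t, hW.mul hY, fun t ht => by rw [mul_pow, hW' t ht, hY' t ht]⟩

/-- An open condition which holds along a continuous path in the plane holds along some
polynomial path. -/
theorem exists_polynomial_path {Y : ℝ → ℂ} (hY : ContinuousOn Y (Set.Icc (-1) 1))
    {Φ : ℝ × ℝ × ℝ → ℝ} (hΦ : Continuous Φ)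
    (hpos : ∀ t ∈ Set.Icc (-1 : ℝ) 1, 0 < Φ ((Y t).re, (Y t).im, t)) :
    ∃ y₁ y₂ : ℝ[X], ∀ t ∈ Set.Icc (-1 : ℝ) 1, 0 < Φ (y₁.eval t, y₂.eval t, t) := by
  have hre : ContinuousOn (fun t => (Y t).re) (Set.Icc (-1) 1) :=
    Complex.continuous_re.comp_continuousOn hY
  have him : ContinuousOn (fun t => (Y t).im) (Set.Icc (-1) 1) :=
    Complex.continuous_im.comp_continuousOn hY
  have hK : IsCompact ((fun t => ((Y t).re, (Y t).im, t)) '' Set.Icc (-1 : ℝ) 1) :=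
    isCompact_Icc.image_of_continuousOn (hre.prodMk (him.prodMk continuousOn_id))
  have hU : IsOpen {p | 0 < Φ p} := isOpen_lt continuous_const hΦ
  obtain ⟨δ, hδ, hsub⟩ := hK.exists_thickening_subset_open hU (by
    rintro _ ⟨t, ht, rfl⟩
    exact hpos t ht)
  obtain ⟨y₁, h₁⟩ := exists_polynomial_near_of_continuousOn (-1) 1 _ hre δ hδ
  obtain ⟨y₂, h₂⟩ := exists_polynomial_near_of_continuousOn (-1) 1 _ him δ hδ
  refine ⟨y₁, y₂, fun t ht => hsub ?_⟩
  rw [Metric.mem_thickening_iff]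
  refine ⟨_, ⟨t, ht, rfl⟩, ?_⟩
  rw [Prod.dist_eq, Prod.dist_eq, max_lt_iff, max_lt_iff]
  exact ⟨h₁ t ht, h₂ t ht, by simpa using hδ⟩

/-- The vectors `(m, c)` and `(m', c')` being spacelike, there is `y` such that the sum of
`(y² m̄, -|y|² c)` and `|y|² (m', c')` is spacelike: take `y` close to a square root of `m m'`,
so that `y² m̄` and `m'` have almost the same argument. -/
theorem exists_polynomial_spacelike {a b c a' b' c' : ℝ[X]}
    (h : ∀ t ∈ Set.Icc (-1 : ℝ) 1,
      (1 - t ^ 2) * c.eval t ^ 2 < a.eval t ^ 2 + b.eval t ^ 2)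
    (h' : ∀ t ∈ Set.Icc (-1 : ℝ) 1,
      (1 - t ^ 2) * c'.eval t ^ 2 < a'.eval t ^ 2 + b'.eval t ^ 2) :
    ∃ y₁ y₂ : ℝ[X], ∀ t ∈ Set.Icc (-1 : ℝ) 1,
      0 < (((y₁ ^ 2 - y₂ ^ 2) * a + 2 * y₁ * y₂ * b + (y₁ ^ 2 + y₂ ^ 2) * a') ^ 2 +
        (2 * y₁ * y₂ * a - (y₁ ^ 2 - y₂ ^ 2) * b + (y₁ ^ 2 + y₂ ^ 2) * b') ^ 2 -
        (1 - X ^ 2) * (-((y₁ ^ 2 + y₂ ^ 2) * c) + (y₁ ^ 2 + y₂ ^ 2) * c') ^ 2).eval t := by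
  let m : ℂ[X] := a.map Complex.ofRealHom + C Complex.I * b.map Complex.ofRealHom
  let m' : ℂ[X] := a'.map Complex.ofRealHom + C Complex.I * b'.map Complex.ofRealHom
  have hm : ∀ t : ℝ, m.eval (t : ℂ) = a.eval t + b.eval t * Complex.I := fun t => by
    simp [m, ReflData.eval_ofReal, mul_comm]
  have hm' : ∀ t : ℝ, m'.eval (t : ℂ) = a'.eval t + b'.eval t * Complex.I := fun t => by
    simp [m', ReflData.eval_ofReal, mul_comm]
  have hp : ∀ t ∈ Set.Icc (-1 : ℝ) 1, 0 ≤ 1 - t ^ 2 := fun t ht => by nlinarith [ht.1, ht.2]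
  have hsq : ∀ t ∈ Set.Icc (-1 : ℝ) 1, 0 < a.eval t ^ 2 + b.eval t ^ 2 := fun t ht =>
    (mul_nonneg (hp t ht) (sq_nonneg _)).trans_lt (h t ht)
  have hsq' : ∀ t ∈ Set.Icc (-1 : ℝ) 1, 0 < a'.eval t ^ 2 + b'.eval t ^ 2 := fun t ht =>
    (mul_nonneg (hp t ht) (sq_nonneg _)).trans_lt (h' t ht)
  have hne : ∀ u v : ℝ, 0 < u ^ 2 + v ^ 2 → (u + v * Complex.I : ℂ) ≠ 0 := by
    intro u v huv h0
    have h1 := congrArg Complex.re h0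
    have h2 := congrArg Complex.im h0
    simp at h1 h2
    rw [h1, h2] at huv
    norm_num at huv
  obtain ⟨Y, hY, hY'⟩ := exists_continuous_sqrt (m * m') fun t ht => by
    rw [eval_mul, hm, hm']
    exact mul_ne_zero (hne _ _ (hsq t ht)) (hne _ _ (hsq' t ht))
  obtain ⟨y₁, y₂, hy⟩ := exists_polynomial_path hY
    (Φ := fun p => ((p.1 ^ 2 - p.2.1 ^ 2) * a.eval p.2.2 + 2 * p.1 * p.2.1 * b.eval p.2.2 +
        (p.1 ^ 2 + p.2.1 ^ 2) * a'.eval p.2.2) ^ 2 +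
      (2 * p.1 * p.2.1 * a.eval p.2.2 - (p.1 ^ 2 - p.2.1 ^ 2) * b.eval p.2.2 +
        (p.1 ^ 2 + p.2.1 ^ 2) * b'.eval p.2.2) ^ 2 -
      (1 - p.2.2 ^ 2) * (-((p.1 ^ 2 + p.2.1 ^ 2) * c.eval p.2.2) +
        (p.1 ^ 2 + p.2.1 ^ 2) * c'.eval p.2.2) ^ 2)
    (by
      have h1 := a.continuous
      have h2 := b.continuous
      have h3 := c.continuous
      have h4 := a'.continuous
      have h5 := b'.continuous
      have h6 := c'.continuous
      fun_prop)
    (by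
      intro t ht
      have h1 := hY' t ht
      rw [eval_mul, hm, hm'] at h1
      have e1 := congrArg Complex.re h1
      have e2 := congrArg Complex.im h1
      simp [sq] at e1 e2
      have hlt := h t ht
      have hlt' := h' t ht
      have hs := hp t ht
      have ha := hsq t ht
      have ha' := hsq' t ht
      dsimp only
      generalize (Y t).re = u at *
      generalize (Y t).im = v at *
      generalize a.eval t = a at *
      generalize b.eval t = b at *
      generalize c.eval t = c at *
      generalize a'.eval t = a' at *
      generalize b'.eval t = b' at *
      generalize c'.eval t = c' at *
      obtain ⟨σ, hσ, hσs⟩ : ∃ σ : ℝ, 0 ≤ σ ∧ σ ^ 2 = 1 - t ^ 2 :=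
        ⟨_, Real.sqrt_nonneg _, Real.sq_sqrt hs⟩
      rw [← hσs] at hlt hlt' ⊢
      obtain ⟨p, hp0, hp⟩ : ∃ p : ℝ, 0 < p ∧ p ^ 2 = a ^ 2 + b ^ 2 :=
        ⟨_, Real.sqrt_pos.2 ha, Real.sq_sqrt ha.le⟩
      obtain ⟨p', hp0', hp'⟩ : ∃ p : ℝ, 0 < p ∧ p ^ 2 = a' ^ 2 + b' ^ 2 :=
        ⟨_, Real.sqrt_pos.2 ha', Real.sq_sqrt ha'.le⟩
      have hu : u ^ 2 - v ^ 2 = a * a' - b * b' := by linarith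
      have hv : 2 * u * v = a * b' + b * a' := by linarith
      have huv : u ^ 2 + v ^ 2 = p * p' := by
        refine (sq_eq_sq₀ (by positivity) (by positivity)).1 ?_
        rw [mul_pow, hp, hp']
        linear_combination (u ^ 2 - v ^ 2 + (a * a' - b * b')) * hu +
          (2 * u * v + (a * b' + b * a')) * hv
      have hc : |σ * c| < p := abs_lt_of_sq_lt_sq (by rw [hp, mul_pow]; exact hlt) hp0.le
      have hc' : |σ * c'| < p' := abs_lt_of_sq_lt_sq (by rw [hp', mul_pow]; exact hlt') hp0'.le
      have hcc : (σ * (c' - c)) ^ 2 < (p + p') ^ 2 := by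
        refine sq_lt_sq.2 ?_
        rw [abs_of_pos (add_pos hp0 hp0'), mul_sub]
        linarith [abs_sub (σ * c') (σ * c)]
      rw [hu, hv, huv]
      have : ((a * a' - b * b') * a + (a * b' + b * a') * b + p * p' * a') ^ 2 +
          ((a * b' + b * a') * a - (a * a' - b * b') * b + p * p' * b') ^ 2 -
          σ ^ 2 * (-(p * p' * c) + p * p' * c') ^ 2 =
          (p * p') ^ 2 * ((p + p') ^ 2 - (σ * (c' - c)) ^ 2) := by
        have e₁ : (a * a' - b * b') * a + (a * b' + b * a') * b + p * p' * a' =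
            a' * (p ^ 2 + p * p') := by rw [hp]; ring
        have e₂ : (a * b' + b * a') * a - (a * a' - b * b') * b + p * p' * b' =
            b' * (p ^ 2 + p * p') := by rw [hp]; ring
        rw [e₁, e₂]
        linear_combination (-(p ^ 2 + p * p') ^ 2) * hp'
      rw [this]
      exact mul_pos (by positivity) (sub_pos.2 hcc))
  refine ⟨y₁, y₂, fun t ht => ?_⟩
  have := hy t ht
  simpa using this

/-! ### Conjugacy of reflections by birational diffeomorphisms -/

/-- Two reflections of the same type with `Q(v) = Q(v')` are conjugate if `Q(v + v')` has no zero
on `[-1, 1]`. -/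
theorem exists_conj_of_add {d d' : ReflData} (he' : d'.e' = d.e')
    (hQ : d.Q = d'.Q)
    (hne : ∀ t ∈ Set.Icc (-1 : ℝ) 1, (d.e * ((d.a + d'.a) ^ 2 + (d.b + d'.b) ^ 2) -
      d.e' * (d.c + d'.c) ^ 2).eval t ≠ 0) :
    ∃ h ∈ AutRealOver, h * d.unit = d'.unit * h := by
  have h0 : d.e * ((d.a + d'.a) ^ 2 + (d.b + d'.b) ^ 2) - d.e' * (d.c + d'.c) ^ 2 ≠ 0 :=
    fun h => hne 0 (by norm_num) (by rw [h, eval_zero])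
  exact ⟨(d.add d' h0).unit, (d.add d' h0).unit_mem_autRealOver hne, d.unit_add_mul he' hQ h0⟩

/-- Two timelike vectors with the same value of `Q` have, after a change of sign, a timelike sum. -/
theorem exists_conj_of_neg {d d' : ReflData} (he : d.e = 1 - X ^ 2) (he' : d.e' = 1)
    (hd : d'.e = 1 - X ^ 2) (hd' : d'.e' = 1) (hQ : d.Q = d'.Q)
    (hneg : ∀ t ∈ Set.Icc (-1 : ℝ) 1, d.Q.eval t < 0) :
    ∃ h ∈ AutRealOver, h * d.unit = d'.unit * h := by
  have hp : ∀ t ∈ Set.Icc (-1 : ℝ) 1, 0 ≤ 1 - t ^ 2 := fun t ht => by nlinarith [ht.1, ht.2]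
  have h1 : ∀ t ∈ Set.Icc (-1 : ℝ) 1,
      (1 - t ^ 2) * (d.a.eval t ^ 2 + d.b.eval t ^ 2) < d.c.eval t ^ 2 := fun t ht => by
    have := hneg t ht
    rw [d.eval_Q, he, he'] at this
    simp at this
    linarith
  have h2 : ∀ t ∈ Set.Icc (-1 : ℝ) 1,
      (1 - t ^ 2) * (d'.a.eval t ^ 2 + d'.b.eval t ^ 2) < d'.c.eval t ^ 2 := fun t ht => by
    have := hneg t ht
    rw [hQ, d'.eval_Q, hd, hd'] at this
    simp at this
    linarith
  have hcc : ∀ t ∈ Set.Icc (-1 : ℝ) 1, d.c.eval t * d'.c.eval t ≠ 0 := fun t ht h0 => by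
    have e1 := (mul_nonneg (hp t ht) (add_nonneg (sq_nonneg (d.a.eval t))
      (sq_nonneg (d.b.eval t)))).trans_lt (h1 t ht)
    have e2 := (mul_nonneg (hp t ht) (add_nonneg (sq_nonneg (d'.a.eval t))
      (sq_nonneg (d'.b.eval t)))).trans_lt (h2 t ht)
    have := mul_pos e1 e2
    rw [← mul_pow, h0] at this
    norm_num at this
  -- The sign of `c c'` is constant, and can be made positive by replacing `v'` by `-v'`.
  obtain ⟨g, hg0, hg2, hpos⟩ : ∃ g : ℝ[X], g ≠ 0 ∧ g ^ 2 = 1 ∧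
      ∀ t ∈ Set.Icc (-1 : ℝ) 1, 0 < d.c.eval t * (g * d'.c).eval t := by
    have hcont : Continuous fun t => d.c.eval t * d'.c.eval t :=
      d.c.continuous.mul d'.c.continuous
    by_cases hs : ∀ t ∈ Set.Icc (-1 : ℝ) 1, 0 < d.c.eval t * d'.c.eval t
    · exact ⟨1, one_ne_zero, by ring, by simpa using hs⟩
    · refine ⟨-1, neg_ne_zero.2 one_ne_zero, by ring, fun t ht => ?_⟩
      by_contra hcon
      push Not at hs
      obtain ⟨u, hu, hu0⟩ := hs
      simp at hcon
      obtain ⟨r, hr, hr0⟩ := isPreconnected_Icc.intermediate_value hu ht hcont.continuousOn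
        ⟨hu0, hcon⟩
      exact hcc r hr hr0
  rw [← d'.unit_scale g hg0]
  refine exists_conj_of_add (d' := d'.scale g hg0) (hd'.trans he'.symm)
    (by rw [d'.scale_Q, hg2, one_mul, hQ]) fun t ht => ne_of_lt ?_
  have hg2' : g.eval t ^ 2 = 1 := by simpa using congrArg (Polynomial.eval t) hg2
  have e1 := h1 t ht
  have e2 := h2 t ht
  have e3 := hpos t ht
  have hs := hp t ht
  rw [he, he']
  simp only [ReflData.scale, eval_mul, eval_sub, eval_add, eval_pow, eval_X, eval_one] at e3 ⊢
  generalize d.a.eval t = a at *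
  generalize d.b.eval t = b at *
  generalize d.c.eval t = c at *
  have e2' : (1 - t ^ 2) * ((g.eval t * d'.a.eval t) ^ 2 + (g.eval t * d'.b.eval t) ^ 2) <
      (g.eval t * d'.c.eval t) ^ 2 := by
    rw [mul_pow, mul_pow, mul_pow, hg2']
    simpa using e2
  generalize g.eval t * d'.a.eval t = a' at *
  generalize g.eval t * d'.b.eval t = b' at *
  generalize g.eval t * d'.c.eval t = c' at *
  -- Cauchy-Schwarz for the form `(1 - t²)(x² + y²)`.
  have hcs : ((1 - t ^ 2) * (a * a' + b * b')) ^ 2 < (c * c') ^ 2 := by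
    calc ((1 - t ^ 2) * (a * a' + b * b')) ^ 2
        ≤ ((1 - t ^ 2) * (a ^ 2 + b ^ 2)) * ((1 - t ^ 2) * (a' ^ 2 + b' ^ 2)) := by
          nlinarith [sq_nonneg ((1 - t ^ 2) * (a * b' - b * a'))]
      _ < c ^ 2 * c' ^ 2 := mul_lt_mul'' e1 e2' (by positivity) (by positivity)
      _ = (c * c') ^ 2 := by ring
  have := lt_of_pow_lt_pow_left₀ 2 e3.le hcs
  nlinarith

/-- Two spacelike vectors with the same value of `Q` are made to have a spacelike sum by a
reflection in a horizontal vector. -/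
theorem exists_conj_of_pos {d d' : ReflData} (he : d.e = 1) (he' : d.e' = 1 - X ^ 2)
    (hd : d'.e = 1) (hd' : d'.e' = 1 - X ^ 2) (hQ : d.Q = d'.Q)
    (hpos : ∀ t ∈ Set.Icc (-1 : ℝ) 1, 0 < d.Q.eval t) :
    ∃ h ∈ AutRealOver, h * d.unit = d'.unit * h := by
  obtain ⟨y₁, y₂, hy⟩ := exists_polynomial_spacelike (a := d.a) (b := d.b) (c := d.c) (a' := d'.a)
    (b' := d'.b) (c' := d'.c)
    (fun t ht => by
      have := hpos t ht
      rw [d.eval_Q, he, he'] at this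
      simp at this
      linarith)
    (fun t ht => by
      have := hpos t ht
      rw [hQ, d'.eval_Q, hd, hd'] at this
      simp at this
      linarith)
  have hyne : ∀ t ∈ Set.Icc (-1 : ℝ) 1, (y₁ ^ 2 + y₂ ^ 2).eval t ≠ 0 := by
    intro t ht h0
    have h := hy t ht
    simp only [eval_add, eval_pow] at h0
    have h1 : y₁.eval t = 0 := pow_eq_zero_iff two_ne_zero |>.1 (by
      linarith [sq_nonneg (y₁.eval t), sq_nonneg (y₂.eval t)])
    have h2 : y₂.eval t = 0 := pow_eq_zero_iff two_ne_zero |>.1 (by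
      linarith [sq_nonneg (y₁.eval t), sq_nonneg (y₂.eval t)])
    simp [h1, h2] at h
  have hy0 : y₁ ^ 2 + y₂ ^ 2 ≠ 0 := fun h => hyne 0 (by norm_num) (by rw [h, eval_zero])
  obtain ⟨h, hh, hconj⟩ := exists_conj_of_add (d := d.mirror y₁ y₂ hy0) (d' := d'.scale _ hy0)
    (hd'.trans he'.symm) (by rw [d.mirror_Q, d'.scale_Q, hQ]) (fun t ht => by
      have := (hy t ht).ne'
      simpa [ReflData.mirror, ReflData.scale, he, he'] using this)
  rw [d'.unit_scale] at hconj
  refine ⟨h * (ReflData.horizontal y₁ y₂ hy0).unit, mul_mem hh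
    ((ReflData.horizontal y₁ y₂ hy0).unit_mem_autRealOver (by
      rw [ReflData.horizontal_Q]; exact hyne)), ?_⟩
  rw [mul_assoc, d.horizontal_mul y₁ y₂ hy0 he', ← mul_assoc, hconj, mul_assoc]

/-- Involutions of `Aut(S(ℝ)/π)` which are conjugate in `Bir(S/π)` are conjugate in
`Aut(S(ℝ)/π)`. -/
theorem exists_conj_of_conj {f f' h : Bir} (hf : f ∈ AutRealOver) (hf' : f' ∈ AutRealOver)
    (hff : f * f = 1) (hf1 : f ≠ 1) (hff' : f' * f' = 1) (hf1' : f' ≠ 1) (hh : h ∈ BirOver)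
    (hc : h * f = f' * h) : ∃ k ∈ AutRealOver, k * f = f' * k := by
  have h0 : (0 : ℝ) ∈ Set.Icc (-1 : ℝ) 1 := by norm_num
  have hr1 : (1 : ℝ) ∈ Set.Icc (-1 : ℝ) 1 := by norm_num
  -- Rescaling the vectors makes the values of `Q` equal.
  have hscale : ∀ {d d' : ReflData} {r : ℝ[X]} (hr : d.Q * d'.Q = r ^ 2) (h1 : d'.Q ≠ 0)
      (h2 : r ≠ 0), (d.scale d'.Q h1).Q = (d'.scale r h2).Q := by
    intro d d' r hr h1 h2
    rw [d.scale_Q, d'.scale_Q, ← hr]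
    ring
  have hr0 : ∀ {d d' : ReflData} {r : ℝ[X]}, d.Q * d'.Q = r ^ 2 → r ≠ 0 := by
    rintro d d' r hr rfl
    exact mul_ne_zero d.Q_ne_zero d'.Q_ne_zero (by rw [hr]; ring)
  rcases exists_refl_of_mem_autRealOver hf hff hf1 with
    ⟨d, he, he', rfl, hQ⟩ | ⟨d, he, he', rfl, hQ⟩ <;>
  rcases exists_refl_of_mem_autRealOver hf' hff' hf1' with
    ⟨d', hd, hd', rfl, hQ'⟩ | ⟨d', hd, hd', rfl, hQ'⟩
  · obtain ⟨r, hr⟩ := exists_Q_mul_Q_eq hh hc (he'.trans hd'.symm) (mul_pos (hQ 0 h0) (hQ' 0 h0))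
    rw [← d.unit_scale d'.Q d'.Q_ne_zero, ← d'.unit_scale r (hr0 hr)]
    refine exists_conj_of_pos he he' hd hd' (hscale hr _ _) fun t ht => ?_
    rw [d.scale_Q, eval_mul, eval_pow]
    exact mul_pos (pow_pos (hQ' t ht) 2) (hQ t ht)
  · obtain ⟨r, hr⟩ := exists_det_mul_det_eq hh hc
    rw [he', hd', one_mul, mul_assoc] at hr
    exact absurd hr (not_isSquare_of_eval_ne_zero (by
      rw [eval_mul]; exact mul_ne_zero (hQ 1 hr1).ne' (hQ' 1 hr1).ne))
  · obtain ⟨r, hr⟩ := exists_det_mul_det_eq hh hc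
    rw [he', hd', one_mul, mul_left_comm] at hr
    exact absurd hr (not_isSquare_of_eval_ne_zero (by
      rw [eval_mul]; exact mul_ne_zero (hQ 1 hr1).ne (hQ' 1 hr1).ne'))
  · obtain ⟨r, hr⟩ := exists_Q_mul_Q_eq hh hc (he'.trans hd'.symm)
      (mul_pos_of_neg_of_neg (hQ 0 h0) (hQ' 0 h0))
    rw [← d.unit_scale d'.Q d'.Q_ne_zero, ← d'.unit_scale r (hr0 hr)]
    refine exists_conj_of_neg he he' hd hd' (hscale hr _ _) fun t ht => ?_
    rw [d.scale_Q, eval_mul, eval_pow]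
    exact mul_neg_of_pos_of_neg (sq_pos_of_neg (hQ' t ht)) (hQ t ht)

end

end RealSphere

theorem mainTheorem5 (g g' : RealSphere.AutRealOver) (hg : orderOf g = 2) (hg' : orderOf g' = 2) :
    IsConj (Subgroup.inclusion RealSphere.AutRealOver_le_BirOver g)
        (Subgroup.inclusion RealSphere.AutRealOver_le_BirOver g') ↔
      IsConj g g' := by
  refine ⟨fun h => ?_, fun h => MonoidHom.map_isConj _ h⟩
  obtain ⟨k, hk⟩ := isConj_iff.1 h
  have hinv : ∀ u : RealSphere.AutRealOver, orderOf u = 2 →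
      (u : RealSphere.Bir) * u = 1 ∧ (u : RealSphere.Bir) ≠ 1 := by
    intro u hu
    constructor
    · have := pow_orderOf_eq_one u
      rw [hu, sq] at this
      exact congrArg Subtype.val this
    · intro h1
      have : u = 1 := Subtype.ext h1
      rw [this, orderOf_one] at hu
      norm_num at hu
  have hc : (k : RealSphere.Bir) * g = g' * k := by
    rw [← mul_inv_eq_iff_eq_mul]
    exact congrArg Subtype.val hk
  obtain ⟨c, hcm, hc'⟩ := RealSphere.exists_conj_of_conj g.2 g'.2 (hinv g hg).1 (hinv g hg).2
    (hinv g' hg').1 (hinv g' hg').2 k.2 hc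
  refine isConj_iff.2 ⟨⟨c, hcm⟩, Subtype.ext ?_⟩
  change c * g * c⁻¹ = g'
  rw [hc', mul_inv_cancel_right]
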